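/- Let $n\ge 1$, $p>1$, and let $\phi:\mathbb{R}^n\to\mathbb{R}$ be non-negative, bounded and continuous. Consider the Cauchy problem $$u_t=\Delta u+|u|^{p-1}u\ \text{ in } \mathbb{R}^n\times(0,T),\qquad u(x,0)=\phi(x)\ \text{ for } x\in\mathbb{R}^n. \tag{P}$$ A classical solution of (P) on $[0,T)$ is a function $u$ that is continuous on $\mathbb{R}^n\times[0,T)$, of class $C^{2,1}$ (twice in $x$, once in $t$) on $\mathbb{R}^n\times(0,T)$, bounded on $\mathbb{R}^n\times[0,S]$ for every $S<T$, and satisfies (P). We say that the classical solution of (P) blows up in finite time, with life span $T^*\in(0,\infty)$, if there is a classical solution $u$ on $[0,T^*)$ such that every classical solution on an interval $[0,S)$, $S>0$, satisfies $S\le T^*$ and agrees with $u$ on $[0,S)$, and $\lim_{t\to T^{*-}}\|u(\cdot,t)\|_{L^\infty(\mathbb{R}^n)}=\infty$. (i) Let $n\ge 2$. For $\xi'\in\mathbb{S}^{n-1}$ and $\delta>0$ put $S_{\xi'}(\delta)=\{x'\in\mathbb{S}^{n-1} : |\xi'-x'|<\delta\}$, and let $\phi_\infty(x')=\liminf_{r\to+\infty}\phi(rx')$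 for $x'\in\mathbb{S}^{n-1}$. Suppose that for some $\xi'\in\mathbb{S}^{n-1}$ and $\delta>0$ $$A:=\operatorname*{ess\,inf}_{x'\in S_{\xi'}(\delta)}\phi_\infty(x')>0,$$ the essential infimum being taken with respect to the surface measure on $\mathbb{S}^{n-1}$. Then the classical solution of (P) blows up in finite time, with life span $$T^*\le\frac{1}{p-1}A^{1-p}.$$ (ii) Let $n=1$ and suppose that $$A:=\max\Bigl\{\liminf_{x\to+\infty}\phi(x),\ \liminf_{x\to-\infty}\phi(x)\Bigr\}>0.$$ Then the classical solution of (P) blows up in finite time, with life span $T^*\le\frac{1}{p-1}A^{1-p}$. -/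

import Mathlib

open Set Filter Topology MeasureTheory
open scoped ENNReal

noncomputable section

/-- Euclidean space `ℝⁿ`. -/
abbrev RSpace (n : ℕ) : Type := EuclideanSpace ℝ (Fin n)

/-- `u : [0, T) → (ℝⁿ → ℝ)` is a (locally in time bounded) classical solution on `ℝⁿ × [0, T)` of
`u_t = Δ u + |u|^(p-1) u`, `u(x, 0) = φ(x)`: it is continuous on `ℝⁿ × [0, T)`, of class `C^{2,1}` on
`ℝⁿ × (0, T)`, and bounded on `ℝⁿ × [0, S]` for every `S < T`. -/
structure IsClassicalSolution {n : ℕ} (p : ℝ) (φ : RSpace n → ℝ) (T : ℝ)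
    (u : ℝ → RSpace n → ℝ) : Prop where
  continuousOn : ContinuousOn (fun q : ℝ × RSpace n => u q.1 q.2) (Ico 0 T ×ˢ univ)
  bounded : ∀ S < T, ∃ M : ℝ, ∀ t ∈ Icc 0 S, ∀ x, |u t x| ≤ M
  contDiff_space : ∀ t ∈ Ioo 0 T, ContDiff ℝ 2 (u t)
  continuousOn_space : ∀ k : ℕ, k ≤ 2 →
    ContinuousOn (fun q : ℝ × RSpace n => iteratedFDeriv ℝ k (u q.1) q.2) (Ioo 0 T ×ˢ univ)
  differentiable_time : ∀ t ∈ Ioo 0 T, ∀ x, DifferentiableAt ℝ (fun s => u s x) t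
  continuousOn_time :
    ContinuousOn (fun q : ℝ × RSpace n => deriv (fun s => u s q.2) q.1) (Ioo 0 T ×ˢ univ)
  equation : ∀ t ∈ Ioo 0 T, ∀ x,
    deriv (fun s => u s x) t = Laplacian.laplacian (u t) x + |u t x| ^ (p - 1) * u t x
  initial : ∀ x, u 0 x = φ x

/-- `u` is the classical solution of the Cauchy problem and `[0, T)` is its maximal interval of
existence: every classical solution lives on a subinterval of `[0, T)` and agrees with `u` there. -/
structure IsMaximalClassicalSolution {n : ℕ} (p : ℝ) (φ : RSpace n → ℝ) (T : ℝ)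
    (u : ℝ → RSpace n → ℝ) : Prop where
  pos : 0 < T
  isSolution : IsClassicalSolution p φ T u
  unique_maximal : ∀ (S : ℝ) (v : ℝ → RSpace n → ℝ), 0 < S → IsClassicalSolution p φ S v →
    S ≤ T ∧ ∀ t ∈ Ico 0 S, ∀ x, v t x = u t x

/-- The classical solution of the Cauchy problem with datum `φ` (exists, is unique, and) blows up in
finite time, with life span `T`: `T` is the end of its maximal interval of existence and
`‖u(·, t)‖_{L^∞(ℝⁿ)} → ∞` as `t → T⁻`. -/
def BlowsUpAt {n : ℕ} (p : ℝ) (φ : RSpace n → ℝ) (T : ℝ) : Prop :=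
  ∃ u : ℝ → RSpace n → ℝ, IsMaximalClassicalSolution p φ T u ∧
    Tendsto (fun t => eLpNorm (u t) ∞ volume) (𝓝[<] T) (𝓝 ∞)

/-- The conic neighbourhood `Γ_ξ(δ)` of the direction `ξ`. -/
def conicNhd {n : ℕ} (ξ : RSpace n) (δ : ℝ) : Set (RSpace n) :=
  {η | η ≠ 0 ∧ ‖ξ - ‖η‖⁻¹ • η‖ < δ}

/-- The spherical cap `S_ξ(δ) = Γ_ξ(δ) ∩ 𝕊ⁿ⁻¹`, as a subset of the unit sphere. -/
def sphericalCap {n : ℕ} (ξ : RSpace n) (δ : ℝ) : Set (Metric.sphere (0 : RSpace n) 1) :=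
  {x | (x : RSpace n) ∈ conicNhd ξ δ}

/-- The radial lower limit `φ_∞(x') = liminf_{r → +∞} φ(r x')`. -/
def radialLiminf {n : ℕ} (φ : RSpace n → ℝ) (x : Metric.sphere (0 : RSpace n) 1) : ℝ :=
  liminf (fun r : ℝ => φ (r • (x : RSpace n))) atTop

/-- The essential infimum of `φ_∞` over the cap `S_ξ(δ)`, for the surface measure of the sphere. -/
def capEssInf {n : ℕ} (φ : RSpace n → ℝ) (ξ : RSpace n) (δ : ℝ) : ℝ :=
  essInf (radialLiminf φ) ((volume : Measure (RSpace n)).toSphere.restrict (sphericalCap ξ δ))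

/-- For `φ` on the line, the larger of `liminf_{x → +∞} φ(x)` and `liminf_{x → -∞} φ(x)`. -/
def lineLiminfMax (φ : RSpace 1 → ℝ) : ℝ :=
  max (liminf (fun x : ℝ => φ !₂[x]) atTop) (liminf (fun x : ℝ => φ !₂[x]) atBot)

end

/-! Let P_t g(x) = E g(x + √(2t) Z), with Z a standard Gaussian vector; this is the heat semigroup.
A non-negative mild solution satisfies u(t) = P_t φ + ∫₀ᵗ P_{t-s} u(s)^p ds. Fix a point a and a
time τ not smaller than the length S of the existence interval. By the semigroup law, F(t) = P_{τ-t}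
u(t)(a) equals P_τ φ(a) + ∫₀ᵗ P_{τ-s} u(s)^p (a) ds, and Jensen's inequality gives F' ≥ F^p.
Comparison with the ordinary differential equation yields S ≤ (P_τ φ(a))^(1-p) / (p-1) whenever P_τ
φ(a) > 0 (`IsMildSolution.le_of_gaussAvg_pos`).

It remains to make P_τ φ(a) almost A with τ arbitrarily large. With a = kξ and √(2τ) = kη one has
P_τ φ(a) = E φ(k(ξ + ηZ)). For small η the vector ξ + ηZ lies in the given cone with probability
close to 1, and as k → ∞ the values of φ along almost every ray of the cone are eventually at least
B, for any B < A (`exists_le_gaussAvg_of_rays`). In dimension one the cone is a half-line.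

The rest relates mild to classical solutions. Mild solutions exist by contraction on a time
depending only on a bound for the datum, so a solution that stays bounded can be continued; at the
supremum of the existence times the norm must therefore tend to infinity (`exists_blowsUpAt`). Mild
solutions are classical by parabolic smoothing: a Gaussian average gains one derivative at the cost
of a factor (t-s)^(-1/2), which is integrable. This is used once for u and once for its gradient,
and the time derivative comes from the generator of the semigroup. Classical solutions are
non-negative and unique by the weak maximum principle. -/

set_option linter.unusedSectionVars false

/-! ### Gaussian averages: smoothing, semigroup law, Jensen's inequality -/

section GaussianAverage

open ProbabilityTheory

variable {E : Type*} [NormedAddCommGroup E] [InnerProductSpace ℝ E] [FiniteDimensional ℝ E]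
  [MeasurableSpace E] [BorelSpace E]
variable {F : Type*} [NormedAddCommGroup F] [NormedSpace ℝ F]

/-- The Lebesgue density of the standard Gaussian measure. -/
noncomputable def gaussDensity (v : E) : ℝ :=
  (∫ w : E, Real.exp (-(1 / 2) * ‖w‖ ^ 2))⁻¹ * Real.exp (-(1 / 2) * ‖v‖ ^ 2)

theorem gaussDensity_nonneg (v : E) : 0 ≤ gaussDensity v := by
  unfold gaussDensity
  have : 0 ≤ ∫ w : E, Real.exp (-(1 / 2) * ‖w‖ ^ 2) :=
    integral_nonneg fun _ => (Real.exp_pos _).le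
  positivity

theorem continuous_gaussDensity : Continuous (gaussDensity (E := E)) := by
  unfold gaussDensity
  fun_prop

theorem integrable_gaussDensity : Integrable (gaussDensity (E := E)) := by
  unfold gaussDensity
  apply Integrable.const_mul
  have h := (GaussianFourier.integrable_cexp_neg_mul_sq_norm_add (b := (1 / 2 : ℂ)) (V := E)
    (by norm_num) 0 0).norm
  refine h.congr (Eventually.of_forall fun v => ?_)
  have : (-(1 / 2 : ℂ) * (‖v‖ : ℂ) ^ 2 + 0 * ((inner ℝ (0 : E) v : ℝ) : ℂ))
      = ((-(1 / 2) * ‖v‖ ^ 2 : ℝ) : ℂ) := by push_cast; ring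
  simp only [this, Complex.norm_exp_ofReal]

/-- Both sides have characteristic function exp(-‖t‖²/2). The density brings in Lebesgue measure,
whose translation invariance gives the Cameron–Martin formula and whose null sets are Gaussian null
sets. -/
theorem stdGaussian_eq_withDensity :
    stdGaussian E = volume.withDensity fun v => ENNReal.ofReal (gaussDensity v) := by
  have hfin : IsFiniteMeasure
      ((volume : Measure E).withDensity fun v => ENNReal.ofReal (gaussDensity v)) :=
    isFiniteMeasure_withDensity_ofReal integrable_gaussDensity.2
  apply Measure.ext_of_charFun
  funext t
  rw [charFun_stdGaussian, charFun_apply, integral_withDensity_eq_integral_toReal_smul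
    (continuous_gaussDensity.measurable.ennreal_ofReal)
    (Eventually.of_forall fun _ => ENNReal.ofReal_lt_top)]
  simp only [ENNReal.toReal_ofReal (gaussDensity_nonneg _)]
  set c : ℝ := ∫ w : E, Real.exp (-(1 / 2) * ‖w‖ ^ 2) with hc
  have h1 := GaussianFourier.integral_cexp_neg_mul_sq_norm_add (b := (1 / 2 : ℂ)) (V := E)
    (by norm_num) Complex.I t
  have h0 := GaussianFourier.integral_cexp_neg_mul_sq_norm_add (b := (1 / 2 : ℂ)) (V := E)
    (by norm_num) 0 0
  have hc0 : (c : ℂ) = (↑Real.pi / (1 / 2 : ℂ)) ^ ((Module.finrank ℝ E : ℂ) / 2) := by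
    have : (c : ℂ) = ∫ v : E, Complex.exp (-(1 / 2 : ℂ) * (‖v‖ : ℂ) ^ 2
        + 0 * ((inner ℝ (0 : E) v : ℝ) : ℂ)) := by
      rw [hc, ← integral_complex_ofReal]
      congr 1
      funext v
      push_cast
      congr 1
      ring
    rw [this, h0]
    simp
  have hcne : (c : ℂ) ≠ 0 := by
    rw [hc0]
    simp [Complex.cpow_eq_zero_iff, Real.pi_ne_zero]
  have : ∀ v : E, gaussDensity v • Complex.exp (((inner ℝ v t : ℝ) : ℂ) * Complex.I)
      = (c : ℂ)⁻¹ * Complex.exp (-(1 / 2 : ℂ) * (‖v‖ : ℂ) ^ 2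
        + Complex.I * ((inner ℝ t v : ℝ) : ℂ)) := by
    intro v
    rw [gaussDensity, ← hc, Complex.real_smul, Complex.exp_add, real_inner_comm t v]
    push_cast
    rw [mul_comm Complex.I]
    ring
  simp_rw [this]
  rw [integral_const_mul, h1, ← hc0, ← mul_assoc, inv_mul_cancel₀ hcne, one_mul]
  congr 1
  rw [Complex.I_sq]
  ring

theorem stdGaussian_absolutelyContinuous : stdGaussian E ≪ (volume : Measure E) := by
  rw [stdGaussian_eq_withDensity]
  exact withDensity_absolutelyContinuous _ _

theorem integral_stdGaussian_eq (g : E → F) :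
    ∫ z, g z ∂(stdGaussian E) = ∫ z : E, gaussDensity z • g z := by
  rw [stdGaussian_eq_withDensity, integral_withDensity_eq_integral_toReal_smul
    (continuous_gaussDensity.measurable.ennreal_ofReal)
    (Eventually.of_forall fun _ => ENNReal.ofReal_lt_top)]
  simp only [ENNReal.toReal_ofReal (gaussDensity_nonneg _)]

/-- The Cameron–Martin formula for the standard Gaussian measure. -/
theorem integral_stdGaussian_comp_add (g : E → F) (v : E) :
    ∫ z, g (z + v) ∂(stdGaussian E)
      = ∫ z, Real.exp (inner ℝ v z - ‖v‖ ^ 2 / 2) • g z ∂(stdGaussian E) := by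
  rw [integral_stdGaussian_eq, integral_stdGaussian_eq,
    ← integral_sub_right_eq_self (fun z : E => gaussDensity z • g (z + v)) v]
  congr 1
  funext z
  rw [sub_add_cancel, smul_smul]
  congr 1
  rw [gaussDensity, gaussDensity, mul_assoc, ← Real.exp_add, norm_sub_sq_real, real_inner_comm]
  congr 2
  ring

/-- By Fernique's theorem. This function dominates the derivative of the Cameron–Martin weight for
shifts of norm less than 1. -/
theorem integrable_exp_norm_stdGaussian :
    Integrable (fun z : E => Real.exp ‖z‖ * (‖z‖ + 1)) (stdGaussian E) := by
  obtain ⟨C, hC, hi⟩ := IsGaussian.exists_integrable_exp_sq (stdGaussian E)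
  refine (hi.const_mul (Real.exp C⁻¹)).mono' (by fun_prop) (Eventually.of_forall fun z => ?_)
  rw [Real.norm_of_nonneg (by positivity), ← Real.exp_add]
  calc Real.exp ‖z‖ * (‖z‖ + 1) ≤ Real.exp ‖z‖ * Real.exp ‖z‖ := by
        gcongr
        exact Real.add_one_le_exp _
    _ = Real.exp (‖z‖ + ‖z‖) := (Real.exp_add _ _).symm
    _ ≤ _ := by
        apply Real.exp_le_exp.2
        -- Completing the square: 2‖z‖ ≤ C‖z‖² + C⁻¹.
        have h1 : 0 ≤ C⁻¹ * (C * ‖z‖ - 1) ^ 2 := by positivity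
        have h2 : C⁻¹ * (C * ‖z‖ - 1) ^ 2 = C * ‖z‖ ^ 2 - 2 * ‖z‖ + C⁻¹ := by
          field_simp
          ring
        linarith

theorem integrable_norm_stdGaussian : Integrable (fun z : E => ‖z‖) (stdGaussian E) :=
  (IsGaussian.integrable_id (μ := stdGaussian E)).norm

/-- The average of `g` over the Gaussian of standard deviation `s` centred at `x`. For
`s = √(2t)` it is the heat semigroup at time `t`. -/
noncomputable def gaussAvg (s : ℝ) (g : E → F) (x : E) : F :=
  ∫ z, g (x + s • z) ∂(stdGaussian E)

/-- `s` times the gradient of `gaussAvg s g`. -/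
noncomputable def gaussGrad (s : ℝ) (g : E → F) (x : E) : E →L[ℝ] F :=
  ∫ z, (innerSL ℝ z).smulRight (g (x + s • z)) ∂(stdGaussian E)

variable (E) in
/-- The mean length of a standard Gaussian vector. -/
noncomputable def gaussMeanNorm : ℝ := ∫ z : E, ‖z‖ ∂(stdGaussian E)

theorem gaussMeanNorm_nonneg : 0 ≤ gaussMeanNorm E := integral_nonneg fun _ => norm_nonneg _

theorem norm_innerSL_smulRight_le (z : E) (y : F) {C : ℝ} (hy : ‖y‖ ≤ C) :
    ‖(innerSL ℝ z).smulRight y‖ ≤ ‖z‖ * C := by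
  rw [ContinuousLinearMap.norm_smulRight_apply, innerSL_apply_norm]
  gcongr

theorem continuous_innerSL_smulRight {X : Type*} [TopologicalSpace X] {a : X → E} {b : X → F}
    (ha : Continuous a) (hb : Continuous b) :
    Continuous fun q => (innerSL ℝ (a q)).smulRight (b q) := by
  have h : Continuous fun q => ContinuousLinearMap.smulRightL ℝ E F (innerSL ℝ (a q)) (b q) := by
    fun_prop
  exact h

theorem integrable_gaussAvg {g : E → F} (hg : Continuous g) {C : ℝ} (hC : ∀ y, ‖g y‖ ≤ C)
    (s : ℝ) (x : E) : Integrable (fun z => g (x + s • z)) (stdGaussian E) :=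
  Integrable.of_bound (C := C) (hg.comp (by fun_prop)).aestronglyMeasurable
    (Eventually.of_forall fun _ => hC _)

theorem integrable_gaussGrad {g : E → F} (hg : Continuous g) {C : ℝ} (hC : ∀ y, ‖g y‖ ≤ C)
    (s : ℝ) (x : E) :
    Integrable (fun z => (innerSL ℝ z).smulRight (g (x + s • z))) (stdGaussian E) :=
  (integrable_norm_stdGaussian.mul_const C).mono'
    (by
      have := secondCountableTopologyEither_of_left E (E →L[ℝ] F)
      exact (continuous_innerSL_smulRight continuous_id
        (hg.comp (by fun_prop))).aestronglyMeasurable)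
    (Eventually.of_forall fun z => norm_innerSL_smulRight_le z _ (hC _))

theorem norm_gaussAvg_le {g : E → F} {C : ℝ} (hC : ∀ y, ‖g y‖ ≤ C) (s : ℝ) (x : E) :
    ‖gaussAvg s g x‖ ≤ C := by
  have h := norm_integral_le_of_norm_le_const (μ := stdGaussian E)
    (Eventually.of_forall fun z => hC (x + s • z))
  rw [probReal_univ, mul_one] at h
  exact h

theorem norm_gaussGrad_le {g : E → F} {C : ℝ} (hC : ∀ y, ‖g y‖ ≤ C) (s : ℝ) (x : E) :
    ‖gaussGrad s g x‖ ≤ gaussMeanNorm E * C := by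
  rw [gaussMeanNorm, ← integral_mul_const]
  exact norm_integral_le_of_norm_le (integrable_norm_stdGaussian.mul_const C)
    (Eventually.of_forall fun z => norm_innerSL_smulRight_le z _ (hC _))

theorem continuous_gaussAvg {X : Type*} [TopologicalSpace X] [FirstCountableTopology X]
    {h : X → E → F} (hh : Continuous fun q : X × E => h q.1 q.2) {C : ℝ}
    (hC : ∀ q y, ‖h q y‖ ≤ C) {s : X → ℝ} (hs : Continuous s) {y : X → E} (hy : Continuous y) :
    Continuous fun q => gaussAvg (s q) (h q) (y q) := by
  refine continuous_of_dominated (bound := fun _ => C) (fun q => ?_)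
    (fun q => Eventually.of_forall fun z => hC _ _) (integrable_const _)
    (Eventually.of_forall fun z => ?_)
  · exact (hh.comp (by fun_prop : Continuous fun z => (q, y q + s q • z))).aestronglyMeasurable
  · exact hh.comp (by fun_prop : Continuous fun q => (q, y q + s q • z))

theorem continuous_gaussGrad {X : Type*} [TopologicalSpace X] [FirstCountableTopology X]
    {h : X → E → F} (hh : Continuous fun q : X × E => h q.1 q.2) {C : ℝ}
    (hC : ∀ q y, ‖h q y‖ ≤ C) {s : X → ℝ} (hs : Continuous s) {y : X → E} (hy : Continuous y) :
    Continuous fun q => gaussGrad (s q) (h q) (y q) := by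
  refine continuous_of_dominated (bound := fun z => ‖z‖ * C) (fun q => ?_)
    (fun q => Eventually.of_forall fun z => norm_innerSL_smulRight_le z _ (hC _ _))
    (integrable_norm_stdGaussian.mul_const C) (Eventually.of_forall fun z => ?_)
  · exact (continuous_innerSL_smulRight continuous_id
      (hh.comp (by fun_prop : Continuous fun z => (q, y q + s q • z)))).aestronglyMeasurable
  · exact continuous_innerSL_smulRight continuous_const
      (hh.comp (by fun_prop : Continuous fun q => (q, y q + s q • z)))

theorem gaussAvg_zero (g : E → F) [CompleteSpace F] (x : E) : gaussAvg 0 g x = g x := by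
  simp [gaussAvg]

/-- Gaussian averages of bounded continuous functions are differentiable. -/
theorem hasFDerivAt_gaussAvg {g : E → F} (hg : Continuous g) {C : ℝ} (hC : ∀ y, ‖g y‖ ≤ C)
    {s : ℝ} (hs : s ≠ 0) (x : E) :
    HasFDerivAt (gaussAvg s g) (s⁻¹ • gaussGrad s g x) x := by
  have hC0 : 0 ≤ C := (norm_nonneg _).trans (hC 0)
  -- Since g is only continuous, the shift by s • v is moved onto the smooth weight exp(⟨v, z⟩ -
  -- ‖v‖²/2), whose derivative at v = 0 is ⟨z, ·⟩.
  have key : HasFDerivAt (fun v : E => ∫ z, Real.exp (inner ℝ v z - ‖v‖ ^ 2 / 2) •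
      g (x + s • z) ∂(stdGaussian E)) (gaussGrad s g x) 0 := by
    have h := hasFDerivAt_integral_of_dominated_of_fderiv_le (μ := stdGaussian E) (𝕜 := ℝ)
      (F := fun (v : E) z => Real.exp (inner ℝ v z - ‖v‖ ^ 2 / 2) • g (x + s • z))
      (F' := fun (v : E) z => (Real.exp (inner ℝ v z - ‖v‖ ^ 2 / 2) •
        innerSL ℝ (z - v)).smulRight (g (x + s • z)))
      (x₀ := (0 : E)) (s := Metric.ball 0 1)
      (bound := fun z => Real.exp ‖z‖ * (‖z‖ + 1) * C) (Metric.ball_mem_nhds _ one_pos)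
      (Eventually.of_forall fun v => ?_) ?_ ?_ ?_
      (integrable_exp_norm_stdGaussian.mul_const C) ?_
    · convert h using 1
      simp [gaussGrad]
    · exact (Continuous.smul (by fun_prop) (hg.comp (by fun_prop))).aestronglyMeasurable
    · simpa using integrable_gaussAvg hg hC s x
    · simpa using (integrable_gaussGrad hg hC s x).aestronglyMeasurable
    · refine Eventually.of_forall fun z v hv => ?_
      have hv : ‖v‖ < 1 := by simpa using hv
      rw [ContinuousLinearMap.norm_smulRight_apply, norm_smul, innerSL_apply_norm,
        Real.norm_of_nonneg (Real.exp_pos _).le]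
      gcongr
      · calc inner ℝ v z - ‖v‖ ^ 2 / 2 ≤ inner ℝ v z := by linarith [sq_nonneg ‖v‖]
          _ ≤ ‖v‖ * ‖z‖ := real_inner_le_norm _ _
          _ ≤ 1 * ‖z‖ := by gcongr
          _ = ‖z‖ := one_mul _
      · exact (norm_sub_le _ _).trans (by linarith)
      · exact hC _
    · refine Eventually.of_forall fun z v _ => ?_
      have h1 : HasFDerivAt (fun v : E => inner ℝ v z - ‖v‖ ^ 2 / 2) (innerSL ℝ (z - v)) v := by
        have ha : HasFDerivAt (fun v : E => inner ℝ v z) (innerSL ℝ z) v := by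
          have := (innerSL ℝ z).hasFDerivAt (x := v)
          refine this.congr_of_eventuallyEq (Eventually.of_forall fun w => ?_)
          simp [real_inner_comm]
        have hb := (hasStrictFDerivAt_norm_sq v).hasFDerivAt
        have := ha.sub (hb.const_mul (1 / 2))
        refine (this.congr_of_eventuallyEq (Eventually.of_forall fun w => ?_)).congr_fderiv ?_
        · simp only [Pi.sub_apply]; ring
        · ext w
          simp
      exact h1.exp.smul_const _
  have heq : ∀ y, gaussAvg s g y = (fun v : E => ∫ z, Real.exp (inner ℝ v z - ‖v‖ ^ 2 / 2) •
      g (x + s • z) ∂(stdGaussian E)) (s⁻¹ • (y - x)) := by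
    intro y
    simp only
    rw [← integral_stdGaussian_comp_add (fun z => g (x + s • z)), gaussAvg]
    congr 1
    funext z
    rw [smul_add, smul_inv_smul₀ hs]
    congr 1
    abel
  have hlin : HasFDerivAt (fun y : E => s⁻¹ • (y - x)) (s⁻¹ • ContinuousLinearMap.id ℝ E) x :=
    ((hasFDerivAt_id x).sub_const x).const_smul s⁻¹
  have h0 : s⁻¹ • (x - x) = 0 := by simp
  have := HasFDerivAt.comp x (by rw [h0]; exact key) hlin
  refine (this.congr_of_eventuallyEq (Eventually.of_forall heq)).congr_fderiv ?_
  ext w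
  simp

/-- When g is already differentiable the derivative falls on g: no factor s⁻¹ appears, and s = 0 is
allowed. -/
theorem hasFDerivAt_gaussAvg_of_hasFDerivAt {g : E → F} {g' : E → E →L[ℝ] F} (hg : Continuous g)
    {C : ℝ} (hC : ∀ y, ‖g y‖ ≤ C) (hg' : Continuous g') {C' : ℝ} (hC' : ∀ y, ‖g' y‖ ≤ C')
    (hd : ∀ y, HasFDerivAt g (g' y) y) (s : ℝ) (x : E) :
    HasFDerivAt (gaussAvg s g) (gaussAvg s g' x) x := by
  refine hasFDerivAt_integral_of_dominated_of_fderiv_le (s := univ) (bound := fun _ => C')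
    (F' := fun y z => g' (y + s • z))
    univ_mem (Eventually.of_forall fun y => (integrable_gaussAvg hg hC s y).aestronglyMeasurable)
    (integrable_gaussAvg hg hC s x) (integrable_gaussAvg hg' hC' s x).aestronglyMeasurable
    (Eventually.of_forall fun z y _ => hC' _) (integrable_const _)
    (Eventually.of_forall fun z y _ => ?_)
  have := (hd (y + s • z)).comp y ((hasFDerivAt_id y).add_const (s • z))
  simpa [Function.comp_def] using this

/-- The semigroup law: a sum of independent centred Gaussians of deviations s and r is a centred
Gaussian of variance s² + r², as characteristic functions show. -/
theorem gaussAvg_gaussAvg {g : E → F} (hg : Continuous g) {C : ℝ} (hC : ∀ y, ‖g y‖ ≤ C)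
    (s r : ℝ) (x : E) :
    gaussAvg s (gaussAvg r g) x = gaussAvg (√(s ^ 2 + r ^ 2)) g x := by
  have hm : ((stdGaussian E).map (fun z => s • z)) ∗ ((stdGaussian E).map (fun z => r • z))
      = (stdGaussian E).map (fun z => √(s ^ 2 + r ^ 2) • z) := by
    have i1 : IsProbabilityMeasure ((stdGaussian E).map (fun z => s • z)) :=
      Measure.isProbabilityMeasure_map (by fun_prop)
    have i2 : IsProbabilityMeasure ((stdGaussian E).map (fun z => r • z)) :=
      Measure.isProbabilityMeasure_map (by fun_prop)
    have i3 : IsProbabilityMeasure ((stdGaussian E).map (fun z => √(s ^ 2 + r ^ 2) • z)) :=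
      Measure.isProbabilityMeasure_map (by fun_prop)
    apply Measure.ext_of_charFun
    funext t
    rw [charFun_conv, charFun_map_smul, charFun_map_smul, charFun_map_smul, charFun_stdGaussian,
      charFun_stdGaussian, charFun_stdGaussian, ← Complex.exp_add]
    congr 1
    have h : ∀ a : ℝ, ((‖a • t‖ : ℝ) : ℂ) ^ 2 = ((a ^ 2 * ‖t‖ ^ 2 : ℝ) : ℂ) := by
      intro a
      rw [← Complex.ofReal_pow, norm_smul, mul_pow, Real.norm_eq_abs, sq_abs]
    rw [h, h, h, Real.sq_sqrt (by positivity)]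
    push_cast
    ring
  have hmeas : ∀ μ : Measure E, AEStronglyMeasurable (fun z => g (x + z)) μ := fun μ =>
    (hg.comp (by fun_prop)).aestronglyMeasurable
  have h1 : gaussAvg (√(s ^ 2 + r ^ 2)) g x
      = ∫ z, g (x + z) ∂((stdGaussian E).map (fun z => √(s ^ 2 + r ^ 2) • z)) := by
    rw [integral_map (by fun_prop) (hmeas _)]
    rfl
  have i1 : IsProbabilityMeasure ((stdGaussian E).map (fun z => s • z)) :=
    Measure.isProbabilityMeasure_map (by fun_prop)
  have i2 : IsProbabilityMeasure ((stdGaussian E).map (fun z => r • z)) :=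
    Measure.isProbabilityMeasure_map (by fun_prop)
  rw [h1, ← hm, integral_conv (Integrable.of_bound (C := C) (hmeas _)
    (Eventually.of_forall fun _ => hC _)), integral_map (by fun_prop)]
  · unfold gaussAvg
    congr 1
    funext z
    rw [integral_map (f := fun y => g (x + (s • z + y))) (by fun_prop)
      (hg.comp (by fun_prop)).aestronglyMeasurable]
    simp only [add_assoc]
  · refine (Continuous.aestronglyMeasurable ?_)
    refine continuous_of_dominated (bound := fun _ => C)
      (fun q => (hg.comp (by fun_prop)).aestronglyMeasurable)
      (fun q => Eventually.of_forall fun z => hC _) (integrable_const _)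
      (Eventually.of_forall fun z => hg.comp (by fun_prop))

theorem gaussAvg_nonneg {g : E → ℝ} (hg : ∀ y, 0 ≤ g y) (s : ℝ) (x : E) : 0 ≤ gaussAvg s g x :=
  integral_nonneg fun _ => hg _

/-- Jensen's inequality for the convex function y ↦ y ^ p on the half-line. -/
theorem gaussAvg_rpow_le {g : E → ℝ} (hg : Continuous g) {C : ℝ} (hC : ∀ y, ‖g y‖ ≤ C)
    (hg0 : ∀ y, 0 ≤ g y) {p : ℝ} (hp : 1 ≤ p) (s : ℝ) (x : E) :
    gaussAvg s g x ^ p ≤ gaussAvg s (fun y => g y ^ p) x := by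
  have hc : Continuous fun y : ℝ => y ^ p := Real.continuous_rpow_const (by linarith)
  refine ConvexOn.map_integral_le (μ := stdGaussian E) (g := fun y : ℝ => y ^ p)
    (convexOn_rpow hp) hc.continuousOn isClosed_Ici
    (Eventually.of_forall fun z => hg0 _) (integrable_gaussAvg hg hC s x) ?_
  refine integrable_gaussAvg (hc.comp hg) (C := C ^ p) (fun y => ?_) s x
  have := hC y
  rw [Real.norm_of_nonneg (hg0 y)] at this
  simp only [Function.comp]
  rw [Real.norm_of_nonneg (Real.rpow_nonneg (hg0 y) p)]
  exact Real.rpow_le_rpow (hg0 y) this (by linarith)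

end GaussianAverage

/-! ### The generator of the heat semigroup and the Duhamel integral -/

section Duhamel

open ProbabilityTheory

variable {E : Type*} [NormedAddCommGroup E] [InnerProductSpace ℝ E] [FiniteDimensional ℝ E]
  [MeasurableSpace E] [BorelSpace E]
variable {F : Type*} [NormedAddCommGroup F] [NormedSpace ℝ F]

/-- Differentiation in s gives E[g'(x + sZ) Z]. Gaussian integration by parts turns this into s
times the average of the trace of g''. It is obtained by equating the two derivatives of `gaussAvg s
g'`: one falls on the Gaussian weight, the other on g'. -/
theorem hasDerivAt_gaussAvg_param {g : E → ℝ} {g' : E → E →L[ℝ] ℝ}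
    {g'' : E → E →L[ℝ] E →L[ℝ] ℝ} (hg : Continuous g) {C : ℝ} (hC : ∀ y, ‖g y‖ ≤ C)
    (hg' : Continuous g') {C' : ℝ} (hC' : ∀ y, ‖g' y‖ ≤ C') (hg'' : Continuous g'') {C'' : ℝ}
    (hC'' : ∀ y, ‖g'' y‖ ≤ C'') (hd : ∀ y, HasFDerivAt g (g' y) y)
    (hd' : ∀ y, HasFDerivAt g' (g'' y) y) {ι : Type*} [Fintype ι] (b : OrthonormalBasis ι ℝ E)
    {s : ℝ} (hs : s ≠ 0) (x : E) :
    HasDerivAt (fun r => gaussAvg r g x)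
      (s * gaussAvg s (fun y => ∑ i, g'' y (b i) (b i)) x) s := by
  have h1 : HasDerivAt (fun r => gaussAvg r g x) (∫ z, g' (x + s • z) z ∂(stdGaussian E)) s := by
    refine (hasDerivAt_integral_of_dominated_loc_of_deriv_le (s := univ)
      (F' := fun r z => g' (x + r • z) z) (bound := fun z => C' * ‖z‖) univ_mem
      (Eventually.of_forall fun r => (integrable_gaussAvg hg hC r x).aestronglyMeasurable)
      (integrable_gaussAvg hg hC s x) ?_ (Eventually.of_forall fun z r _ => ?_)
      (integrable_norm_stdGaussian.const_mul C') (Eventually.of_forall fun z r _ => ?_)).2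
    · exact (Continuous.clm_apply (hg'.comp (by fun_prop)) continuous_id).aestronglyMeasurable
    · exact ContinuousLinearMap.le_of_opNorm_le _ (hC' _) z
    · have h2 : HasDerivAt (fun r : ℝ => x + r • z) z r := by
        simpa using ((hasDerivAt_id r).smul_const z).const_add x
      exact (hd (x + r • z)).comp_hasDerivAt r h2
  have h2 : gaussGrad s g' x = s • gaussAvg s g'' x := by
    rw [← (hasFDerivAt_gaussAvg hg' hC' hs x).unique
      (hasFDerivAt_gaussAvg_of_hasFDerivAt hg' hC' hg'' hC'' hd' s x), smul_inv_smul₀ hs]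
  have h3 : ∀ i, Integrable (fun z => g'' (x + s • z) (b i) (b i)) (stdGaussian E) := by
    intro i
    exact ((integrable_gaussAvg hg'' hC'' s x).apply_continuousLinearMap (b i)
      ).apply_continuousLinearMap (b i)
  have h4 : ∀ i, (gaussAvg s g'' x) (b i) (b i) = ∫ z, g'' (x + s • z) (b i) (b i)
      ∂(stdGaussian E) := by
    intro i
    rw [gaussAvg, ContinuousLinearMap.integral_apply (integrable_gaussAvg hg'' hC'' s x),
      ContinuousLinearMap.integral_apply
        ((integrable_gaussAvg hg'' hC'' s x).apply_continuousLinearMap (b i))]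
  have h5 : ∀ i, (gaussGrad s g' x) (b i) (b i) = ∫ z, inner ℝ z (b i) * g' (x + s • z) (b i)
      ∂(stdGaussian E) := by
    intro i
    rw [gaussGrad, ContinuousLinearMap.integral_apply (integrable_gaussGrad hg' hC' s x),
      ContinuousLinearMap.integral_apply
        ((integrable_gaussGrad hg' hC' s x).apply_continuousLinearMap (b i))]
    rfl
  have h6 : ∫ z, g' (x + s • z) z ∂(stdGaussian E) = ∑ i, (gaussGrad s g' x) (b i) (b i) := by
    simp only [h5]
    rw [← integral_finsetSum]
    · congr 1
      funext z
      conv_lhs => rw [← b.sum_repr z]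
      rw [map_sum, b.sum_repr]
      refine Finset.sum_congr rfl fun i _ => ?_
      rw [map_smul, b.repr_apply_apply, real_inner_comm, smul_eq_mul]
    · intro i _
      exact ((integrable_gaussGrad hg' hC' s x).apply_continuousLinearMap (b i)
        ).apply_continuousLinearMap (b i)
  convert h1 using 1
  rw [h6, h2, gaussAvg, integral_finsetSum _ fun i _ => h3 i, Finset.mul_sum]
  refine Finset.sum_congr rfl fun i _ => ?_
  rw [← h4]
  rfl

/-- The generator of the heat semigroup is the Laplacian. -/
theorem hasDerivWithinAt_heat_zero {g : E → ℝ} {g' : E → E →L[ℝ] ℝ}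
    {g'' : E → E →L[ℝ] E →L[ℝ] ℝ} (hg : Continuous g) {C : ℝ} (hC : ∀ y, ‖g y‖ ≤ C)
    (hg' : Continuous g') {C' : ℝ} (hC' : ∀ y, ‖g' y‖ ≤ C') (hg'' : Continuous g'') {C'' : ℝ}
    (hC'' : ∀ y, ‖g'' y‖ ≤ C'') (hd : ∀ y, HasFDerivAt g (g' y) y)
    (hd' : ∀ y, HasFDerivAt g' (g'' y) y) {ι : Type*} [Fintype ι] (b : OrthonormalBasis ι ℝ E)
    (x : E) :
    HasDerivWithinAt (fun r => gaussAvg (√(2 * r)) g x) (∑ i, g'' x (b i) (b i)) (Ici 0) 0 := by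
  have hL : Continuous fun y => ∑ i, g'' y (b i) (b i) := by fun_prop
  have hLb : ∀ y, ‖∑ i, g'' y (b i) (b i)‖ ≤ Fintype.card ι * C'' := by
    intro y
    refine (norm_sum_le _ _).trans ?_
    rw [← nsmul_eq_mul, ← Finset.card_univ]
    refine Finset.sum_le_card_nsmul _ _ _ fun i _ => ?_
    have := ((g'' y) (b i)).le_opNorm (b i)
    have h2 := (g'' y).le_opNorm (b i)
    simp only [OrthonormalBasis.norm_eq_one, mul_one] at this h2
    exact this.trans (h2.trans (hC'' y))
  have hder : ∀ r > 0, HasDerivAt (fun r => gaussAvg (√(2 * r)) g x)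
      (gaussAvg (√(2 * r)) (fun y => ∑ i, g'' y (b i) (b i)) x) r := by
    intro r hr
    have h0 : √(2 * r) ≠ 0 := by positivity
    have h1 : HasDerivAt (fun r : ℝ => √(2 * r)) (2 / (2 * √(2 * r))) r := by
      have := ((hasDerivAt_id r).const_mul 2).sqrt (by simp; positivity)
      simpa using this
    have h2 := (hasDerivAt_gaussAvg_param hg hC hg' hC' hg'' hC'' hd hd' b h0 x).comp r h1
    refine h2.congr_deriv ?_
    field_simp
  -- The square root is not differentiable at 0, so the one-sided derivative there is found as the
  -- limit of the derivatives at r > 0.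
  refine hasDerivWithinAt_Ici_of_tendsto_deriv (s := Ioi 0)
    (fun r hr => (hder r hr).differentiableAt.differentiableWithinAt) ?_ self_mem_nhdsWithin ?_
  · exact (continuous_gaussAvg (X := ℝ) (h := fun _ => g) (hg.comp continuous_snd)
      (fun _ => hC) (s := fun r => √(2 * r)) (by fun_prop)
      (y := fun _ => x) continuous_const).continuousWithinAt
  · have hc := continuous_gaussAvg (X := ℝ) (h := fun _ y => ∑ i, g'' y (b i) (b i))
      (hL.comp continuous_snd) (fun _ => hLb) (s := fun r => √(2 * r)) (by fun_prop)
      (y := fun _ => x) continuous_const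
    have ht := hc.tendsto 0
    simp only [mul_zero, Real.sqrt_zero, gaussAvg_zero] at ht
    refine (ht.mono_left nhdsWithin_le_nhds).congr' ?_
    filter_upwards [self_mem_nhdsWithin] with r hr
    exact (hder r hr).deriv.symm

/-- The Duhamel integral `∫₀ᵗ P_{t-s} h(s) ds` of the heat semigroup `P`, desingularised by the
substitution `s = t - tσ²`. -/
noncomputable def duhamel (h : ℝ → E → F) (t : ℝ) (x : E) : F :=
  ∫ σ in (0 : ℝ)..1, (2 * t * σ) • gaussAvg (√(2 * t) * σ) (h (t - t * σ ^ 2)) x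

/-- The spatial gradient of the Duhamel integral. -/
noncomputable def duhamelGrad (h : ℝ → E → F) (t : ℝ) (x : E) : E →L[ℝ] F :=
  √(2 * t) • ∫ σ in (0 : ℝ)..1, gaussGrad (√(2 * t) * σ) (h (t - t * σ ^ 2)) x

variable {h : ℝ → E → F} {C : ℝ}

theorem continuous_duhamel_integrand (hh : Continuous fun q : ℝ × E => h q.1 q.2)
    (hC : ∀ s y, ‖h s y‖ ≤ C) :
    Continuous fun q : (ℝ × E) × ℝ =>
      gaussAvg (√(2 * q.1.1) * q.2) (h (q.1.1 - q.1.1 * q.2 ^ 2)) q.1.2 :=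
  continuous_gaussAvg (X := (ℝ × E) × ℝ) (h := fun q => h (q.1.1 - q.1.1 * q.2 ^ 2))
    (hh.comp (by fun_prop : Continuous fun q : ((ℝ × E) × ℝ) × E =>
      (q.1.1.1 - q.1.1.1 * q.1.2 ^ 2, q.2))) (fun _ _ => hC _ _) (by fun_prop) (by fun_prop)

theorem continuous_duhamelGrad_integrand (hh : Continuous fun q : ℝ × E => h q.1 q.2)
    (hC : ∀ s y, ‖h s y‖ ≤ C) :
    Continuous fun q : (ℝ × E) × ℝ =>
      gaussGrad (√(2 * q.1.1) * q.2) (h (q.1.1 - q.1.1 * q.2 ^ 2)) q.1.2 :=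
  continuous_gaussGrad (X := (ℝ × E) × ℝ) (h := fun q => h (q.1.1 - q.1.1 * q.2 ^ 2))
    (hh.comp (by fun_prop : Continuous fun q : ((ℝ × E) × ℝ) × E =>
      (q.1.1.1 - q.1.1.1 * q.1.2 ^ 2, q.2))) (fun _ _ => hC _ _) (by fun_prop) (by fun_prop)

theorem continuous_duhamel (hh : Continuous fun q : ℝ × E => h q.1 q.2)
    (hC : ∀ s y, ‖h s y‖ ≤ C) : Continuous fun q : ℝ × E => duhamel h q.1 q.2 := by
  refine intervalIntegral.continuous_parametric_intervalIntegral_of_continuous'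
    (f := fun (q : ℝ × E) σ => (2 * q.1 * σ) • gaussAvg (√(2 * q.1) * σ)
      (h (q.1 - q.1 * σ ^ 2)) q.2) ?_ 0 1
  exact Continuous.smul (by fun_prop) (continuous_duhamel_integrand hh hC)

theorem continuous_duhamelGrad (hh : Continuous fun q : ℝ × E => h q.1 q.2)
    (hC : ∀ s y, ‖h s y‖ ≤ C) : Continuous fun q : ℝ × E => duhamelGrad h q.1 q.2 := by
  refine Continuous.smul (f := fun q : ℝ × E => √(2 * q.1)) (by fun_prop) ?_
  exact intervalIntegral.continuous_parametric_intervalIntegral_of_continuous'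
    (f := fun (q : ℝ × E) σ => gaussGrad (√(2 * q.1) * σ)
      (h (q.1 - q.1 * σ ^ 2)) q.2) (continuous_duhamelGrad_integrand hh hC) 0 1

theorem norm_duhamel_le (hC : ∀ s y, ‖h s y‖ ≤ C) {t : ℝ} (ht : 0 ≤ t) (x : E) :
    ‖duhamel h t x‖ ≤ t * C := by
  have h1 : ‖duhamel h t x‖ ≤ ∫ σ in (0 : ℝ)..1, 2 * t * σ * C := by
    refine intervalIntegral.norm_integral_le_of_norm_le zero_le_one
      (Eventually.of_forall fun σ hσ => ?_) (Continuous.intervalIntegrable (by fun_prop) _ _)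
    have hσ0 : 0 < σ := hσ.1
    rw [norm_smul, Real.norm_of_nonneg (by positivity)]
    gcongr
    exact norm_gaussAvg_le (fun y => hC _ y) _ _
  refine h1.trans_eq ?_
  rw [intervalIntegral.integral_mul_const, intervalIntegral.integral_const_mul, integral_id]
  ring

theorem norm_duhamelGrad_le (hC : ∀ s y, ‖h s y‖ ≤ C) (t : ℝ) (x : E) :
    ‖duhamelGrad h t x‖ ≤ √(2 * t) * (gaussMeanNorm E * C) := by
  rw [duhamelGrad, norm_smul, Real.norm_of_nonneg (Real.sqrt_nonneg _)]
  gcongr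
  have := intervalIntegral.norm_integral_le_of_norm_le_const (a := 0) (b := 1)
    (C := gaussMeanNorm E * C)
    (f := fun σ => gaussGrad (√(2 * t) * σ) (h (t - t * σ ^ 2)) x)
    fun σ _ => norm_gaussGrad_le (fun y => hC _ y) _ _
  simpa using this

/-- The gradient of the average costs (√(2t) σ)⁻¹, which the Jacobian 2tσ of the substitution
absorbs, leaving the bounded factor √(2t). -/
theorem hasFDerivAt_duhamel (hh : Continuous fun q : ℝ × E => h q.1 q.2)
    (hC : ∀ s y, ‖h s y‖ ≤ C) {t : ℝ} (ht : 0 < t) (x : E) :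
    HasFDerivAt (duhamel h t) (duhamelGrad h t x) x := by
  rw [duhamelGrad, ← intervalIntegral.integral_smul]
  have hC0 : 0 ≤ C := (norm_nonneg _).trans (hC 0 0)
  have hA := continuous_duhamel_integrand hh hC
  have hB := continuous_duhamelGrad_integrand hh hC
  have hA' : ∀ y, Continuous fun σ =>
      (2 * t * σ) • gaussAvg (√(2 * t) * σ) (h (t - t * σ ^ 2)) y := fun y =>
    Continuous.smul (by fun_prop)
      (hA.comp (by fun_prop : Continuous fun σ : ℝ => (((t, y) : ℝ × E), σ)))
  refine intervalIntegral.hasFDerivAt_integral_of_dominated_of_fderiv_le (𝕜 := ℝ) (s := univ)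
    (F := fun y σ => (2 * t * σ) • gaussAvg (√(2 * t) * σ) (h (t - t * σ ^ 2)) y)
    (F' := fun y σ => √(2 * t) • gaussGrad (√(2 * t) * σ) (h (t - t * σ ^ 2)) y)
    (bound := fun _ => √(2 * t) * (gaussMeanNorm E * C)) univ_mem
    (Eventually.of_forall fun y => (hA' y).aestronglyMeasurable)
    ((hA' x).intervalIntegrable _ _) ?_ (Eventually.of_forall fun σ hσ y _ => ?_)
    (continuous_const.intervalIntegrable _ _) (Eventually.of_forall fun σ hσ y _ => ?_)
  · exact ((hB.comp (by fun_prop : Continuous fun σ : ℝ => (((t, x) : ℝ × E), σ))).const_smul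
      (√(2 * t))).aestronglyMeasurable
  · rw [norm_smul, Real.norm_of_nonneg (Real.sqrt_nonneg _)]
    gcongr
    exact norm_gaussGrad_le (fun y => hC _ y) _ _
  · rw [uIoc_of_le zero_le_one] at hσ
    have hσ0 : 0 < σ := hσ.1
    have hs : √(2 * t) * σ ≠ 0 := by positivity
    have hd := (hasFDerivAt_gaussAvg (hh.comp (by fun_prop : Continuous fun y : E =>
      (t - t * σ ^ 2, y))) (fun y => hC _ y) hs y).const_smul (2 * t * σ)
    refine hd.congr_fderiv ?_
    rw [smul_smul]
    congr 1
    have : √(2 * t) * √(2 * t) = 2 * t := Real.mul_self_sqrt (by positivity)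
    field_simp
    linarith

theorem sub_mul_sq_mem_Icc {t σ : ℝ} (ht : 0 ≤ t) (h0 : 0 ≤ σ) (h1 : σ ≤ 1) :
    t - t * σ ^ 2 ∈ Icc 0 t := by
  have h2 : t * σ ^ 2 ≤ t := mul_le_of_le_one_right ht (pow_le_one₀ h0 h1)
  have h3 : 0 ≤ t * σ ^ 2 := by positivity
  constructor <;> linarith

theorem hasFDerivAt_duhamel_of_hasFDerivAt {h' : ℝ → E → E →L[ℝ] F} {C' : ℝ}
    (hh : Continuous fun q : ℝ × E => h q.1 q.2) (hC : ∀ s y, ‖h s y‖ ≤ C)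
    (hh' : Continuous fun q : ℝ × E => h' q.1 q.2) (hC' : ∀ s y, ‖h' s y‖ ≤ C')
    {t : ℝ} (ht : 0 ≤ t) (hd : ∀ s ∈ Icc 0 t, ∀ y, HasFDerivAt (h s) (h' s y) y) (x : E) :
    HasFDerivAt (duhamel h t) (duhamel h' t x) x := by
  have hA := continuous_duhamel_integrand hh hC
  have hB := continuous_duhamel_integrand hh' hC'
  have hA' : ∀ y, Continuous fun σ =>
      (2 * t * σ) • gaussAvg (√(2 * t) * σ) (h (t - t * σ ^ 2)) y := fun y =>
    Continuous.smul (by fun_prop)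
      (hA.comp (by fun_prop : Continuous fun σ : ℝ => (((t, y) : ℝ × E), σ)))
  refine intervalIntegral.hasFDerivAt_integral_of_dominated_of_fderiv_le (𝕜 := ℝ) (s := univ)
    (F := fun y σ => (2 * t * σ) • gaussAvg (√(2 * t) * σ) (h (t - t * σ ^ 2)) y)
    (F' := fun y σ => (2 * t * σ) • gaussAvg (√(2 * t) * σ) (h' (t - t * σ ^ 2)) y)
    (bound := fun σ => ‖2 * t * σ‖ * C') univ_mem
    (Eventually.of_forall fun y => (hA' y).aestronglyMeasurable)
    ((hA' x).intervalIntegrable _ _) ?_ (Eventually.of_forall fun σ hσ y _ => ?_)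
    (Continuous.intervalIntegrable (by fun_prop) _ _) (Eventually.of_forall fun σ hσ y _ => ?_)
  · exact (Continuous.smul (f := fun σ => 2 * t * σ) (by fun_prop)
      (hB.comp (by fun_prop : Continuous fun σ : ℝ => (((t, x) : ℝ × E), σ)))).aestronglyMeasurable
  · rw [norm_smul]
    gcongr
    exact norm_gaussAvg_le (fun y => hC' _ y) _ _
  · rw [uIoc_of_le zero_le_one] at hσ
    refine HasFDerivAt.const_smul ?_ (2 * t * σ)
    refine hasFDerivAt_gaussAvg_of_hasFDerivAt
      (hh.comp (by fun_prop : Continuous fun y : E => (t - t * σ ^ 2, y))) (fun y => hC _ y)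
      (hh'.comp (by fun_prop : Continuous fun y : E => (t - t * σ ^ 2, y))) (fun y => hC' _ y)
      (fun y => hd _ (sub_mul_sq_mem_Icc ht hσ.1.le hσ.2) y) _ _

/-- Only times in [0, t] enter, so a source may be altered outside that interval to make it globally
bounded and continuous. -/
theorem duhamel_congr {h' : ℝ → E → F} {t : ℝ} (ht : 0 ≤ t)
    (heq : ∀ s ∈ Icc 0 t, h s = h' s) : duhamel h t = duhamel h' t := by
  funext x
  refine intervalIntegral.integral_congr fun σ hσ => ?_
  rw [uIcc_of_le zero_le_one] at hσ
  rw [heq _ (sub_mul_sq_mem_Icc ht hσ.1 hσ.2)]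

theorem continuous_heat_shift (hh : Continuous fun q : ℝ × E => h q.1 q.2)
    (hC : ∀ s y, ‖h s y‖ ≤ C) (t : ℝ) :
    Continuous fun q : ℝ × E => gaussAvg (√(2 * (t - q.1))) (h q.1) q.2 :=
  continuous_gaussAvg (X := ℝ × E) (h := fun q => h q.1)
    (hh.comp (by fun_prop : Continuous fun q : (ℝ × E) × E => (q.1.1, q.2)))
    (fun _ _ => hC _ _) (by fun_prop) (by fun_prop)

/-- Undoing the substitution s = t - tσ². The original form is the one suited to Fubini's theorem
and to splitting the time interval. -/
theorem duhamel_eq_integral (hh : Continuous fun q : ℝ × E => h q.1 q.2)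
    (hC : ∀ s y, ‖h s y‖ ≤ C) {t : ℝ} (ht : 0 ≤ t) (x : E) :
    duhamel h t x = ∫ s in (0 : ℝ)..t, gaussAvg (√(2 * (t - s))) (h s) x := by
  have hc : Continuous fun s : ℝ => gaussAvg (√(2 * (t - s))) (h s) x :=
    (continuous_heat_shift hh hC t).comp (by fun_prop : Continuous fun s : ℝ => (s, x))
  have hsub := intervalIntegral.integral_deriv_smul_comp (a := (0 : ℝ)) (b := 1)
    (f := fun σ => t - t * σ ^ 2) (f' := fun σ => -(2 * t * σ))
    (g := fun s : ℝ => gaussAvg (√(2 * (t - s))) (h s) x)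
    (fun σ _ => by
      have := ((hasDerivAt_pow 2 σ).const_mul t).const_sub t
      refine this.congr_deriv ?_
      simp
      ring) (by fun_prop) hc
  simp only [Function.comp, ne_eq, OfNat.ofNat_ne_zero, not_false_eq_true, zero_pow, mul_zero,
    sub_zero, one_pow, mul_one, sub_self, sub_sub_cancel] at hsub
  rw [intervalIntegral.integral_symm, ← hsub, ← intervalIntegral.integral_neg]
  refine intervalIntegral.integral_congr fun σ hσ => ?_
  rw [uIcc_of_le zero_le_one] at hσ
  simp only [neg_smul, neg_neg]
  congr 2
  rw [← mul_assoc, Real.sqrt_mul (by positivity : 0 ≤ 2 * t), Real.sqrt_sq hσ.1]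

/-- Fubini's theorem and the semigroup law. -/
theorem gaussAvg_duhamel (hh : Continuous fun q : ℝ × E => h q.1 q.2)
    (hC : ∀ s y, ‖h s y‖ ≤ C) {t r : ℝ} (ht : 0 ≤ t) (hr : 0 ≤ r) (x : E) :
    gaussAvg (√(2 * r)) (duhamel h t) x
      = ∫ s in (0 : ℝ)..t, gaussAvg (√(2 * (t + r - s))) (h s) x := by
  have h1 : gaussAvg (√(2 * r)) (duhamel h t) x = ∫ z, (∫ s in (0 : ℝ)..t,
      gaussAvg (√(2 * (t - s))) (h s) (x + √(2 * r) • z)) ∂(stdGaussian E) := by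
    unfold gaussAvg
    congr 1
    funext z
    exact duhamel_eq_integral hh hC ht _
  rw [h1, ← intervalIntegral_integral_swap]
  · refine intervalIntegral.integral_congr fun s hs => ?_
    rw [uIcc_of_le ht] at hs
    have hsg := gaussAvg_gaussAvg (g := h s) (hh.comp (by fun_prop : Continuous fun y : E => (s, y)))
      (fun y => hC _ y) (√(2 * r)) (√(2 * (t - s))) x
    have hs0 : 0 ≤ t - s := by linarith [hs.2]
    rw [Real.sq_sqrt (by positivity), Real.sq_sqrt (by positivity)] at hsg
    rw [show 2 * r + 2 * (t - s) = 2 * (t + r - s) by ring] at hsg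
    exact hsg
  · have : IsFiniteMeasure (volume.restrict (uIoc 0 t)) := by
      rw [uIoc_of_le ht]
      infer_instance
    have hc := (continuous_heat_shift hh hC t).comp
      (by fun_prop : Continuous fun q : ℝ × E => (q.1, x + √(2 * r) • q.2))
    exact Integrable.of_bound (C := C) hc.aestronglyMeasurable
      (Eventually.of_forall fun q => norm_gaussAvg_le (fun y => hC _ y) _ _)

/-- The integral over [0, t + r] is split at t: the first piece is the earlier Duhamel integral
carried forward by P_r, the second has the shifted source. Restarting and gluing rest on this. -/
theorem duhamel_add (hh : Continuous fun q : ℝ × E => h q.1 q.2)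
    (hC : ∀ s y, ‖h s y‖ ≤ C) {t r : ℝ} (ht : 0 ≤ t) (hr : 0 ≤ r) (x : E) :
    duhamel h (t + r) x
      = gaussAvg (√(2 * r)) (duhamel h t) x + duhamel (fun s => h (t + s)) r x := by
  have hc : Continuous fun s : ℝ => gaussAvg (√(2 * (t + r - s))) (h s) x :=
    (continuous_heat_shift hh hC (t + r)).comp (by fun_prop : Continuous fun s : ℝ => (s, x))
  rw [gaussAvg_duhamel hh hC ht hr, duhamel_eq_integral hh hC (add_nonneg ht hr),
    duhamel_eq_integral (h := fun s => h (t + s))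
      (hh.comp (by fun_prop : Continuous fun q : ℝ × E => (t + q.1, q.2)))
      (fun s y => hC _ y) hr]
  have h2 := intervalIntegral.integral_comp_add_left (a := 0) (b := r)
    (fun s : ℝ => gaussAvg (√(2 * (t + r - s))) (h s) x) t
  rw [add_zero] at h2
  rw [← intervalIntegral.integral_add_adjacent_intervals (hc.intervalIntegrable 0 t)
    (hc.intervalIntegrable t (t + r)), ← h2]
  congr 2
  funext s
  congr 3
  ring

theorem duhamel_zero (h : ℝ → E → F) (x : E) : duhamel h 0 x = 0 := by
  simp [duhamel]

/-- The substitution makes the Duhamel integral t • K(t) with K continuous, and K(0) = h 0 x because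
2σ has integral 1 over [0, 1]. -/
theorem hasDerivWithinAt_duhamel_zero [CompleteSpace F]
    (hh : Continuous fun q : ℝ × E => h q.1 q.2)
    (hC : ∀ s y, ‖h s y‖ ≤ C) (x : E) :
    HasDerivWithinAt (fun t => duhamel h t x) (h 0 x) (Ici 0) 0 := by
  have hA := continuous_duhamel_integrand hh hC
  set K : ℝ → F := fun t => ∫ σ in (0 : ℝ)..1,
    (2 * σ) • gaussAvg (√(2 * t) * σ) (h (t - t * σ ^ 2)) x with hK
  have hKc : Continuous K := by
    refine intervalIntegral.continuous_parametric_intervalIntegral_of_continuous'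
      (f := fun (t : ℝ) σ => (2 * σ) • gaussAvg (√(2 * t) * σ) (h (t - t * σ ^ 2)) x) ?_ 0 1
    exact Continuous.smul (by fun_prop)
      (hA.comp (by fun_prop : Continuous fun q : ℝ × ℝ => (((q.1, x) : ℝ × E), q.2)))
  have hK0 : K 0 = h 0 x := by
    simp only [hK, mul_zero, Real.sqrt_zero, zero_mul, sub_zero, gaussAvg_zero]
    rw [intervalIntegral.integral_smul_const, intervalIntegral.integral_const_mul, integral_id]
    norm_num
  have heq : ∀ t, duhamel h t x = t • K t := by
    intro t
    rw [hK, duhamel, ← intervalIntegral.integral_smul]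
    congr 1
    funext σ
    rw [smul_smul]
    congr 1
    ring
  rw [hasDerivWithinAt_iff_tendsto_slope]
  have := (hKc.tendsto 0).mono_left (nhdsWithin_le_nhds (s := Ici 0 \ {0}))
  rw [hK0] at this
  refine this.congr' ?_
  filter_upwards [self_mem_nhdsWithin] with t ht
  have ht0 : t ≠ 0 := ht.2
  rw [slope_def_module, heq, duhamel_zero, sub_zero, sub_zero, inv_smul_smul₀ ht0]

end Duhamel

/-! ### Mild solutions: restarting, gluing, first-order smoothing -/

section Mild

open ProbabilityTheory

variable {E : Type*} [NormedAddCommGroup E] [InnerProductSpace ℝ E] [FiniteDimensional ℝ E]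
  [MeasurableSpace E] [BorelSpace E]
variable {F : Type*} [NormedAddCommGroup F] [NormedSpace ℝ F]

/-- Non-negative mild solutions of `u_t = Δ u + u ^ p` with initial datum `φ`. -/
structure IsMildSolution (p : ℝ) (φ : E → ℝ) (S : ℝ) (u : ℝ → E → ℝ) : Prop where
  continuousOn : ContinuousOn (fun q : ℝ × E => u q.1 q.2) (Ico 0 S ×ˢ univ)
  bounded : ∀ T < S, ∃ M : ℝ, ∀ t ∈ Icc 0 T, ∀ x, u t x ≤ M
  nonneg : ∀ t ∈ Ico 0 S, ∀ x, 0 ≤ u t x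
  eq_add_duhamel : ∀ t ∈ Ico 0 S, ∀ x,
    u t x = gaussAvg (√(2 * t)) φ x + duhamel (fun s x => u s x ^ p) t x

/-- Projection of the real line onto `[0, T]`. -/
noncomputable def clampIcc (T s : ℝ) : ℝ := max 0 (min T s)

theorem continuous_clampIcc (T : ℝ) : Continuous (clampIcc T) := by
  unfold clampIcc
  fun_prop

theorem clampIcc_mem {T : ℝ} (hT : 0 ≤ T) (s : ℝ) : clampIcc T s ∈ Icc 0 T :=
  ⟨le_max_left _ _, max_le hT (min_le_left _ _)⟩

theorem clampIcc_eq {T s : ℝ} (hs : s ∈ Icc 0 T) : clampIcc T s = s := by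
  rw [clampIcc, min_eq_right hs.2, max_eq_right hs.1]

theorem continuous_clampIcc_comp {G : Type*} [TopologicalSpace G] {k : ℝ → E → G} {A : Set ℝ}
    (hk : ContinuousOn (fun q : ℝ × E => k q.1 q.2) (A ×ˢ univ)) {T : ℝ} (hT : 0 ≤ T)
    (hA : Icc 0 T ⊆ A) : Continuous fun q : ℝ × E => k (clampIcc T q.1) q.2 := by
  have h1 : Continuous fun q : ℝ × E => (clampIcc T q.1, q.2) :=
    ((continuous_clampIcc T).comp continuous_fst).prodMk continuous_snd
  exact hk.comp_continuous h1 fun q => ⟨hA (clampIcc_mem hT _), mem_univ _⟩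

theorem continuousOn_slice {G : Type*} [TopologicalSpace G] {k : ℝ → E → G} {A : Set ℝ}
    (hk : ContinuousOn (fun q : ℝ × E => k q.1 q.2) (A ×ˢ univ)) {t : ℝ} (ht : t ∈ A) :
    Continuous (k t) :=
  hk.comp_continuous (by fun_prop : Continuous fun x : E => (t, x)) fun _ => ⟨ht, mem_univ _⟩

namespace IsMildSolution

variable {p S : ℝ} {φ : E → ℝ} {u : ℝ → E → ℝ}

theorem exists_norm_le (hu : IsMildSolution p φ S u) {T : ℝ} (hT : T < S) :
    ∃ M : ℝ, 0 ≤ M ∧ ∀ t ∈ Icc 0 T, ∀ x, ‖u t x‖ ≤ M := by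
  obtain ⟨M, hM⟩ := hu.bounded T hT
  refine ⟨max M 0, le_max_right _ _, fun t ht x => ?_⟩
  rw [Real.norm_of_nonneg (hu.nonneg t ⟨ht.1, ht.2.trans_lt hT⟩ x)]
  exact (hM t ht x).trans (le_max_left _ _)

theorem continuous_slice (hu : IsMildSolution p φ S u) {t : ℝ} (ht : t ∈ Ico 0 S) :
    Continuous (u t) := continuousOn_slice hu.continuousOn ht

theorem zero (hu : IsMildSolution p φ S u) (hS : 0 < S) : u 0 = φ := by
  funext x
  rw [hu.eq_add_duhamel 0 ⟨le_rfl, hS⟩, duhamel_zero, mul_zero, Real.sqrt_zero, gaussAvg_zero,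
    add_zero]

/-- Clamping time to [0, T] makes the source u ^ p globally continuous and bounded, as the Duhamel
lemmas require; on [0, T] nothing changes. -/
theorem continuous_source (hu : IsMildSolution p φ S u) (hp : 1 < p) {T : ℝ} (hT : T ∈ Ico 0 S) :
    Continuous fun q : ℝ × E => u (clampIcc T q.1) q.2 ^ p :=
  (continuous_clampIcc_comp hu.continuousOn hT.1
    (fun _ hs => ⟨hs.1, hs.2.trans_lt hT.2⟩)).rpow_const fun _ => Or.inr (by linarith)

theorem exists_norm_source_le (hu : IsMildSolution p φ S u) (hp : 1 < p) {T : ℝ}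
    (hT : T ∈ Ico 0 S) : ∃ M : ℝ, ∀ s x, ‖u (clampIcc T s) x ^ p‖ ≤ M := by
  obtain ⟨M, hM0, hM⟩ := hu.exists_norm_le hT.2
  refine ⟨M ^ p, fun s x => ?_⟩
  rw [Real.norm_rpow_of_nonneg (hu.nonneg _ (by
    have := clampIcc_mem hT.1 s
    exact ⟨this.1, this.2.trans_lt hT.2⟩) x)]
  exact Real.rpow_le_rpow (norm_nonneg _) (hM _ (clampIcc_mem hT.1 s) x) (by linarith)

theorem eq_add_duhamel_clamp (hu : IsMildSolution p φ S u) {T t : ℝ} (hT : T < S)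
    (ht : t ∈ Icc 0 T) :
    u t = fun x => gaussAvg (√(2 * t)) φ x + duhamel (fun s x => u (clampIcc T s) x ^ p) t x := by
  funext x
  rw [hu.eq_add_duhamel t ⟨ht.1, ht.2.trans_lt hT⟩]
  congr 1
  refine congrFun (duhamel_congr ht.1 fun s hs => ?_) x
  rw [clampIcc_eq ⟨hs.1, hs.2.trans ht.2⟩]

theorem restart (hu : IsMildSolution p φ S u) (hp : 1 < p) (hφ : Continuous φ) {C : ℝ}
    (hC : ∀ x, ‖φ x‖ ≤ C) {t₀ : ℝ} (ht₀ : t₀ ∈ Ico 0 S) :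
    IsMildSolution p (u t₀) (S - t₀) fun t => u (t₀ + t) where
  continuousOn := by
    refine hu.continuousOn.comp
      (by fun_prop : Continuous fun q : ℝ × E => (t₀ + q.1, q.2)).continuousOn ?_
    rintro ⟨t, x⟩ ⟨⟨h1, h2⟩, -⟩
    exact ⟨⟨by linarith [ht₀.1], by linarith⟩, mem_univ _⟩
  bounded T hT := by
    obtain ⟨M, hM⟩ := hu.bounded (t₀ + T) (by linarith)
    exact ⟨M, fun t ht x => hM _ ⟨by linarith [ht₀.1, ht.1], by linarith [ht.2]⟩ x⟩
  nonneg t ht x := hu.nonneg _ ⟨by linarith [ht₀.1, ht.1], by linarith [ht.2]⟩ x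
  eq_add_duhamel t ht x := by
    have hT : t₀ + t ∈ Ico 0 S := ⟨by linarith [ht₀.1, ht.1], by linarith [ht.2]⟩
    have hc := hu.continuous_source hp hT
    obtain ⟨M, hM⟩ := hu.exists_norm_source_le hp hT
    rw [congrFun (hu.eq_add_duhamel_clamp hT.2 (t := t₀ + t) ⟨hT.1, le_rfl⟩) x,
      hu.eq_add_duhamel_clamp hT.2 (t := t₀) ⟨ht₀.1, by linarith [ht.1]⟩,
      duhamel_add hc hM ht₀.1 ht.1, ← add_assoc]
    congr 1
    · have h1 := gaussAvg_gaussAvg hφ hC (√(2 * t)) (√(2 * t₀)) x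
      rw [Real.sq_sqrt (by linarith [ht.1]), Real.sq_sqrt (by linarith [ht₀.1]),
        show 2 * t + 2 * t₀ = 2 * (t₀ + t) by ring] at h1
      rw [← h1]
      refine (integral_add ?_ ?_).symm
      · refine integrable_gaussAvg (g := gaussAvg (√(2 * t₀)) φ) ?_
          (fun y => norm_gaussAvg_le hC _ y) _ _
        exact continuous_gaussAvg (X := E) (h := fun _ => φ) (hφ.comp continuous_snd)
          (fun _ => hC) continuous_const continuous_id
      · exact integrable_gaussAvg ((continuous_duhamel hc hM).comp
          (by fun_prop : Continuous fun y : E => (t₀, y)))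
          (fun y => norm_duhamel_le hM ht₀.1 y) _ _
    · refine congrFun (duhamel_congr ht.1 fun s hs => ?_) x
      funext y
      rw [clampIcc_eq ⟨by linarith [ht₀.1, hs.1], by linarith [hs.2]⟩]

theorem congr (hu : IsMildSolution p φ S u) {v : ℝ → E → ℝ} (hv : ∀ t ∈ Ico 0 S, v t = u t) :
    IsMildSolution p φ S v where
  continuousOn := hu.continuousOn.congr fun q hq => by rw [hv _ hq.1]
  bounded T hT := by
    obtain ⟨M, hM⟩ := hu.bounded T hT
    exact ⟨M, fun t ht x => by rw [hv t ⟨ht.1, ht.2.trans_lt hT⟩]; exact hM t ht x⟩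
  nonneg t ht x := by rw [hv t ht]; exact hu.nonneg t ht x
  eq_add_duhamel t ht x := by
    rw [hv t ht, hu.eq_add_duhamel t ht]
    congr 1
    refine congrFun (duhamel_congr ht.1 fun s hs => ?_) x
    rw [hv s ⟨hs.1, hs.2.trans_lt ht.2⟩]

theorem of_forall_lt {v : ℝ → E → ℝ} (hv : ∀ T < S, IsMildSolution p φ T v) :
    IsMildSolution p φ S v where
  continuousOn := by
    rintro ⟨t, x⟩ ⟨⟨h1, h2⟩, -⟩
    obtain ⟨T, hT1, hT2⟩ := exists_between h2
    refine ((hv T hT2).continuousOn (t, x) ⟨⟨h1, hT1⟩, mem_univ _⟩).mono_of_mem_nhdsWithin ?_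
    have : Iio T ×ˢ univ ∈ 𝓝 (t, x) := (isOpen_Iio.prod isOpen_univ).mem_nhds ⟨hT1, mem_univ _⟩
    filter_upwards [self_mem_nhdsWithin, mem_nhdsWithin_of_mem_nhds this] with q h3 h4
    exact ⟨⟨h3.1.1, h4.1⟩, mem_univ _⟩
  bounded T hT := by
    obtain ⟨T', h1, h2⟩ := exists_between hT
    exact (hv T' h2).bounded T h1
  nonneg t ht x := by
    obtain ⟨T, h1, h2⟩ := exists_between ht.2
    exact (hv T h2).nonneg t ⟨ht.1, h1⟩ x
  eq_add_duhamel t ht x := by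
    obtain ⟨T, h1, h2⟩ := exists_between ht.2
    exact (hv T h2).eq_add_duhamel t ⟨ht.1, h1⟩ x

/-- Gluing a mild solution to one that starts from its value at time `t₀`. -/
theorem glue (hu : IsMildSolution p φ S u) (hp : 1 < p) (hφ : Continuous φ) {C : ℝ}
    (hC : ∀ x, ‖φ x‖ ≤ C) {t₀ : ℝ} (ht₀ : t₀ ∈ Ico 0 S) {S' : ℝ} (hS' : 0 < S')
    {v : ℝ → E → ℝ} (hv : IsMildSolution p (u t₀) S' v) :
    IsMildSolution p φ (t₀ + S') fun t => if t ≤ t₀ then u t else v (t - t₀) := by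
  set w : ℝ → E → ℝ := fun t => if t ≤ t₀ then u t else v (t - t₀) with hw
  have hwu : ∀ t ≤ t₀, w t = u t := fun t ht => if_pos ht
  -- The two formulas agree at t₀ because v starts from u t₀, so each may be used on an interval
  -- that contains t₀.
  have hwv : ∀ t, t₀ ≤ t → w t = v (t - t₀) := by
    intro t ht
    rcases ht.eq_or_lt with rfl | h
    · rw [hwu _ le_rfl, sub_self, hv.zero hS']
    · exact if_neg (not_le.2 h)
  have hcont : ContinuousOn (fun q : ℝ × E => w q.1 q.2) (Ico 0 (t₀ + S') ×ˢ univ) := by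
    have h1 : ContinuousOn (fun q : ℝ × E => w q.1 q.2) (Icc 0 t₀ ×ˢ univ) :=
      (hu.continuousOn.mono (prod_mono (fun t ht => ⟨ht.1, ht.2.trans_lt ht₀.2⟩) le_rfl)).congr
        fun q hq => by rw [hwu _ hq.1.2]
    have h2 : ContinuousOn (fun q : ℝ × E => w q.1 q.2) (Ico t₀ (t₀ + S') ×ˢ univ) := by
      refine (hv.continuousOn.comp
        (by fun_prop : Continuous fun q : ℝ × E => (q.1 - t₀, q.2)).continuousOn ?_).congr
        fun q hq => by rw [hwv _ hq.1.1]; rfl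
      rintro ⟨t, x⟩ ⟨⟨h1, h2⟩, -⟩
      exact ⟨⟨by linarith, by linarith⟩, mem_univ _⟩
    rintro ⟨t, x⟩ ⟨⟨ha, hb⟩, -⟩
    rcases lt_trichotomy t t₀ with h | h | h
    · refine (h1 (t, x) ⟨⟨ha, h.le⟩, mem_univ _⟩).mono_of_mem_nhdsWithin ?_
      have : Iio t₀ ×ˢ univ ∈ 𝓝 (t, x) :=
        (isOpen_Iio.prod isOpen_univ).mem_nhds ⟨h, mem_univ _⟩
      filter_upwards [self_mem_nhdsWithin, mem_nhdsWithin_of_mem_nhds this] with q h3 h4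
      exact ⟨⟨h3.1.1, (le_of_lt h4.1)⟩, mem_univ _⟩
    · have h12 := (h1 (t, x) ⟨⟨ha, h.le⟩, mem_univ _⟩).union (h2 (t, x) ⟨⟨h.ge, hb⟩, mem_univ _⟩)
      refine h12.mono ?_
      rintro ⟨s, y⟩ ⟨⟨hs1, hs2⟩, -⟩
      rcases le_total s t₀ with h' | h'
      · exact Or.inl ⟨⟨hs1, h'⟩, mem_univ _⟩
      · exact Or.inr ⟨⟨h', hs2⟩, mem_univ _⟩
    · refine (h2 (t, x) ⟨⟨h.le, hb⟩, mem_univ _⟩).mono_of_mem_nhdsWithin ?_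
      have : Ioi t₀ ×ˢ univ ∈ 𝓝 (t, x) :=
        (isOpen_Ioi.prod isOpen_univ).mem_nhds ⟨h, mem_univ _⟩
      filter_upwards [self_mem_nhdsWithin, mem_nhdsWithin_of_mem_nhds this] with q h3 h4
      exact ⟨⟨(le_of_lt h4.1), h3.1.2⟩, mem_univ _⟩
  have hbdd : ∀ T < t₀ + S', ∃ M : ℝ, ∀ t ∈ Icc 0 T, ∀ x, w t x ≤ M := by
    intro T hT
    obtain ⟨M, hM⟩ := hu.bounded t₀ ht₀.2
    obtain ⟨M', hM'⟩ := hv.bounded (T - t₀) (by linarith)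
    refine ⟨max M M', fun t ht x => ?_⟩
    rcases le_total t t₀ with h | h
    · rw [hwu t h]
      exact (hM t ⟨ht.1, h⟩ x).trans (le_max_left _ _)
    · rw [hwv t h]
      exact (hM' _ ⟨by linarith, by linarith [ht.2]⟩ x).trans (le_max_right _ _)
  have hnn : ∀ t ∈ Ico 0 (t₀ + S'), ∀ x, 0 ≤ w t x := by
    intro t ht x
    rcases le_total t t₀ with h | h
    · rw [hwu t h]
      exact hu.nonneg t ⟨ht.1, h.trans_lt ht₀.2⟩ x
    · rw [hwv t h]
      exact hv.nonneg _ ⟨by linarith, by linarith [ht.2]⟩ x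
  refine ⟨hcont, hbdd, hnn, fun t ht x => ?_⟩
  rcases le_total t t₀ with h | h
  · rw [hwu t h, hu.eq_add_duhamel t ⟨ht.1, h.trans_lt ht₀.2⟩]
    congr 1
    refine congrFun (duhamel_congr ht.1 fun s hs => ?_) x
    rw [hwu s (hs.2.trans h)]
  · set r := t - t₀ with hr
    have hr0 : 0 ≤ r := by linarith
    have htr : t = t₀ + r := by linarith
    have hkc : Continuous fun q : ℝ × E => w (clampIcc t q.1) q.2 ^ p :=
      (continuous_clampIcc_comp hcont ht.1
        (fun _ hs => ⟨hs.1, hs.2.trans_lt ht.2⟩)).rpow_const fun _ => Or.inr (by linarith)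
    obtain ⟨M, hM⟩ := hbdd t ht.2
    have hkM : ∀ s y, ‖w (clampIcc t s) y ^ p‖ ≤ M ^ p := by
      intro s y
      have hm := clampIcc_mem ht.1 s
      have h0 := hnn _ ⟨hm.1, hm.2.trans_lt ht.2⟩ y
      rw [Real.norm_of_nonneg (Real.rpow_nonneg h0 p)]
      exact Real.rpow_le_rpow h0 (hM _ hm y) (by linarith)
    have e1 : duhamel (fun s x => w s x ^ p) t x
        = duhamel (fun s x => w (clampIcc t s) x ^ p) t x := by
      refine congrFun (duhamel_congr ht.1 fun s hs => ?_) x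
      rw [clampIcc_eq hs]
    have e2 : duhamel (fun s x => w (clampIcc t s) x ^ p) t₀ = duhamel (fun s x => u s x ^ p) t₀ :=
      duhamel_congr ht₀.1 fun s hs => by
        rw [clampIcc_eq ⟨hs.1, hs.2.trans h⟩, hwu s hs.2]
    have e3 : duhamel (fun s x => w (clampIcc t (t₀ + s)) x ^ p) r
        = duhamel (fun s x => v s x ^ p) r :=
      duhamel_congr hr0 fun s hs => by
        rw [clampIcc_eq ⟨by linarith [ht₀.1, hs.1], by linarith [hs.2]⟩,
          hwv _ (by linarith [hs.1]), add_sub_cancel_left]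
    -- Splitting at t₀ needs a single source, built from w; by e2 and e3 its two halves are the
    -- sources of u and of the shifted v.
    have e4 : duhamel (fun s x => w (clampIcc t s) x ^ p) t x
        = gaussAvg (√(2 * r)) (duhamel (fun s x => w (clampIcc t s) x ^ p) t₀) x
          + duhamel (fun s x => w (clampIcc t (t₀ + s)) x ^ p) r x := by
      have := duhamel_add hkc hkM ht₀.1 hr0 x
      rwa [← htr] at this
    have hint1 : Continuous (gaussAvg (√(2 * t₀)) φ) :=
      continuous_gaussAvg (X := E) (h := fun _ => φ) (hφ.comp continuous_snd)
          (fun _ => hC) continuous_const continuous_id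
    have hint2 : Continuous (duhamel (fun s x => w (clampIcc t s) x ^ p) t₀) :=
      (continuous_duhamel hkc hkM).comp (by fun_prop : Continuous fun y : E => (t₀, y))
    have hi1 := integrable_gaussAvg hint1 (fun y => norm_gaussAvg_le hC _ y) (√(2 * r)) x
    have hi2 := integrable_gaussAvg hint2 (fun y => norm_duhamel_le hkM ht₀.1 y) (√(2 * r)) x
    rw [hwv t h, hv.eq_add_duhamel r ⟨hr0, by linarith [ht.2]⟩, e1, e4, e3, ← add_assoc]
    congr 1
    have h1 := gaussAvg_gaussAvg hφ hC (√(2 * r)) (√(2 * t₀)) x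
    rw [Real.sq_sqrt (by linarith), Real.sq_sqrt (by linarith [ht₀.1]),
      show 2 * r + 2 * t₀ = 2 * t by rw [htr]; ring] at h1
    rw [← h1]
    have h2 : u t₀ = fun y => gaussAvg (√(2 * t₀)) φ y
        + duhamel (fun s x => w (clampIcc t s) x ^ p) t₀ y := by
      funext y
      rw [e2, hu.eq_add_duhamel t₀ ht₀]
    rw [h2]
    exact integral_add hi1 hi2

end IsMildSolution

/-- Parabolic smoothing for the linear heat equation with bounded continuous source. -/
theorem exists_hasFDerivAt_of_eq_add_duhamel {U k : ℝ → E → F} {ψ : E → F} {T C C' : ℝ}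
    (hψ : Continuous ψ) (hψC : ∀ x, ‖ψ x‖ ≤ C) (hk : Continuous fun q : ℝ × E => k q.1 q.2)
    (hkC : ∀ s x, ‖k s x‖ ≤ C')
    (hU : ∀ t ∈ Icc 0 T, U t = fun x => gaussAvg (√(2 * t)) ψ x + duhamel k t x) :
    ∃ U' : ℝ → E → E →L[ℝ] F, (∀ t ∈ Ioc 0 T, ∀ x, HasFDerivAt (U t) (U' t x) x) ∧
      ContinuousOn (fun q : ℝ × E => U' q.1 q.2) (Ioi 0 ×ˢ univ) ∧
      ∀ a > 0, ∃ M, ∀ t ∈ Icc a T, ∀ x, ‖U' t x‖ ≤ M := by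
  refine ⟨fun t x => (√(2 * t))⁻¹ • gaussGrad (√(2 * t)) ψ x + duhamelGrad k t x, ?_, ?_, ?_⟩
  · intro t ht x
    rw [hU t ⟨ht.1.le, ht.2⟩]
    have h0 : √(2 * t) ≠ 0 := by
      have := ht.1
      positivity
    exact (hasFDerivAt_gaussAvg hψ hψC h0 x).add (hasFDerivAt_duhamel hk hkC ht.1 x)
  · refine ContinuousOn.add ?_ (continuous_duhamelGrad hk hkC).continuousOn
    refine ContinuousOn.smul (f := fun q : ℝ × E => (√(2 * q.1))⁻¹) ?_ ?_
    · refine ContinuousOn.inv₀ (by fun_prop) ?_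
      rintro ⟨t, x⟩ ⟨ht, -⟩
      have : 0 < t := ht
      positivity
    · exact (continuous_gaussGrad (X := ℝ × E) (h := fun _ => ψ) (hψ.comp continuous_snd)
        (fun _ => hψC) (s := fun q => √(2 * q.1)) (by fun_prop) (y := fun q => q.2)
        (by fun_prop)).continuousOn
  · intro a ha
    refine ⟨(√(2 * a))⁻¹ * (gaussMeanNorm E * C) + √(2 * T) * (gaussMeanNorm E * C'),
      fun t ht x => ?_⟩
    have hm := gaussMeanNorm_nonneg (E := E)
    have hC0 : 0 ≤ C := (norm_nonneg _).trans (hψC 0)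
    have hC0' : 0 ≤ C' := (norm_nonneg _).trans (hkC 0 0)
    refine (norm_add_le _ _).trans (add_le_add ?_ ?_)
    · rw [norm_smul, norm_inv, Real.norm_of_nonneg (Real.sqrt_nonneg _)]
      have := ht.1
      gcongr
      exact norm_gaussGrad_le hψC _ _
    · refine (norm_duhamelGrad_le hkC t x).trans ?_
      have := ht.2
      gcongr

end Mild

/-! ### Regularity of mild solutions in space and time -/

section Regularity

variable {E : Type*} [NormedAddCommGroup E] [InnerProductSpace ℝ E] [FiniteDimensional ℝ E]
  [MeasurableSpace E] [BorelSpace E]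

theorem continuousOn_of_forall_Ioo {G : Type*} [TopologicalSpace G] {k : ℝ × E → G} {S : ℝ}
    (h : ∀ a T, 0 < a → T < S → ContinuousOn k (Ioo a T ×ˢ univ)) :
    ContinuousOn k (Ioo 0 S ×ˢ univ) := by
  rintro ⟨t, x⟩ ⟨⟨h1, h2⟩, -⟩
  obtain ⟨a, ha1, ha2⟩ := exists_between h1
  obtain ⟨T, hT1, hT2⟩ := exists_between h2
  exact ((h a T ha1 hT2).continuousAt
    ((isOpen_Ioo.prod isOpen_univ).mem_nhds ⟨⟨ha2, hT1⟩, mem_univ _⟩)).continuousWithinAt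

/-- A continuous function with a continuous right derivative is differentiable. -/
theorem hasDerivAt_of_hasDerivWithinAt_Ici {f g : ℝ → ℝ} {a b t : ℝ} (ht : t ∈ Ioo a b)
    (hf : ContinuousOn f (Ioo a b)) (hg : ContinuousOn g (Ioo a b))
    (hd : ∀ s ∈ Ioo a b, HasDerivWithinAt f (g s) (Ici s) s) : HasDerivAt f (g t) t := by
  obtain ⟨c, hc1, hc2⟩ := exists_between ht.1
  obtain ⟨d, hd1, hd2⟩ := exists_between ht.2
  have hsub : Icc c d ⊆ Ioo a b := fun s hs => ⟨hc1.trans_le hs.1, hs.2.trans_lt hd2⟩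
  -- The difference between f and this primitive of g has right derivative zero, hence is constant
  -- on [c, d].
  have hI : ∀ s ∈ Icc c d, HasDerivAt (fun r => ∫ x in c..r, g x) (g s) s := by
    intro s hs
    refine intervalIntegral.integral_hasDerivAt_right ?_ ?_ ?_
    · refine (hg.mono ?_).intervalIntegrable
      rw [uIcc_of_le hs.1]
      exact (Icc_subset_Icc_right hs.2).trans hsub
    · exact hg.stronglyMeasurableAtFilter isOpen_Ioo s (hsub hs)
    · exact hg.continuousAt (isOpen_Ioo.mem_nhds (hsub hs))
  have hconst := constant_of_has_deriv_right_zero (f := fun r => f r - ∫ x in c..r, g x)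
    (a := c) (b := d)
    ((hf.mono hsub).sub fun s hs => (hI s hs).continuousAt.continuousWithinAt)
    (fun s hs => by
      have hs' : s ∈ Icc c d := ⟨hs.1, hs.2.le⟩
      have h := (hd s (hsub hs')).sub (hI s hs').hasDerivWithinAt
      rwa [sub_self] at h)
  have heq : f =ᶠ[𝓝 t] fun r => (∫ x in c..r, g x) + f c := by
    filter_upwards [Icc_mem_nhds hc2 hd1] with r hr
    have := hconst r hr
    simp only [intervalIntegral.integral_same, sub_zero] at this
    linarith
  exact ((hI t ⟨hc2.le, hd1.le⟩).add_const (f c)).congr_of_eventuallyEq heq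

namespace IsMildSolution

variable {p S : ℝ} {φ : E → ℝ} {u : ℝ → E → ℝ}

theorem fderiv_regularity (hu : IsMildSolution p φ S u) (hp : 1 < p) (hφ : Continuous φ) {C : ℝ}
    (hC : ∀ x, ‖φ x‖ ≤ C) :
    (∀ t ∈ Ioo 0 S, ∀ x, HasFDerivAt (u t) (fderiv ℝ (u t) x) x) ∧
      ContinuousOn (fun q : ℝ × E => fderiv ℝ (u q.1) q.2) (Ioo 0 S ×ˢ univ) ∧
      ∀ a T, 0 < a → T < S → ∃ M, ∀ t ∈ Icc a T, ∀ x, ‖fderiv ℝ (u t) x‖ ≤ M := by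
  -- The derivative U' supplied by smoothing depends on T; uniqueness of derivatives identifies it
  -- with `fderiv` for every T.
  have key : ∀ T ∈ Ico 0 S, ∃ U' : ℝ → E → E →L[ℝ] ℝ,
      (∀ t ∈ Ioc 0 T, ∀ x, HasFDerivAt (u t) (U' t x) x) ∧
      ContinuousOn (fun q : ℝ × E => U' q.1 q.2) (Ioi 0 ×ˢ univ) ∧
      ∀ a > 0, ∃ M, ∀ t ∈ Icc a T, ∀ x, ‖U' t x‖ ≤ M := by
    intro T hT
    obtain ⟨M, hM⟩ := hu.exists_norm_source_le hp hT
    exact exists_hasFDerivAt_of_eq_add_duhamel hφ hC (hu.continuous_source hp hT) hM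
      fun t ht => hu.eq_add_duhamel_clamp hT.2 ht
  refine ⟨fun t ht x => ?_, ?_, fun a T ha hT => ?_⟩
  · obtain ⟨U', h1, -⟩ := key t ⟨ht.1.le, ht.2⟩
    exact (h1 t ⟨ht.1, le_rfl⟩ x).differentiableAt.hasFDerivAt
  · refine continuousOn_of_forall_Ioo fun a T ha hT => ?_
    rcases le_or_gt T a with h | h
    · simp [Ioo_eq_empty (not_lt.2 h)]
    obtain ⟨U', h1, h2, -⟩ := key T ⟨by linarith, hT⟩
    refine (h2.mono (prod_mono (fun t ht => ha.trans ht.1) le_rfl)).congr fun q hq => ?_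
    exact (h1 q.1 ⟨ha.trans hq.1.1, hq.1.2.le⟩ q.2).fderiv
  · rcases le_or_gt T a with h | h
    · by_cases hTa : T = a
      · subst hTa
        obtain ⟨U', h1, -, h3⟩ := key T ⟨ha.le, hT⟩
        obtain ⟨M, hM⟩ := h3 T ha
        refine ⟨M, fun t ht x => ?_⟩
        rw [(h1 t ⟨ha.trans_le ht.1, ht.2⟩ x).fderiv]
        exact hM t ht x
      · exact ⟨0, fun t ht => absurd (ht.1.trans ht.2) (not_le.2 (lt_of_le_of_ne h hTa))⟩
    obtain ⟨U', h1, -, h3⟩ := key T ⟨by linarith, hT⟩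
    obtain ⟨M, hM⟩ := h3 a ha
    refine ⟨M, fun t ht x => ?_⟩
    rw [(h1 t ⟨ha.trans_le ht.1, ht.2⟩ x).fderiv]
    exact hM t ht x

/-- From t₀ > 0 on, the datum u t₀ has a bounded continuous gradient, so the mild formula can be
differentiated under the averages. The gradient then solves a linear problem with the bounded
continuous source p u^(p-1) ∇u, to which the smoothing lemma applies again. -/
theorem fderiv_eq_add_duhamel (hu : IsMildSolution p φ S u) (hp : 1 < p) (hφ : Continuous φ)
    {C : ℝ} (hC : ∀ x, ‖φ x‖ ≤ C) {t₀ T : ℝ} (ht₀ : 0 < t₀) (hT : 0 ≤ T) (hTS : t₀ + T < S) :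
    ∃ k : ℝ → E → E →L[ℝ] ℝ, Continuous (fun q : ℝ × E => k q.1 q.2) ∧
      (∃ M, ∀ s x, ‖k s x‖ ≤ M) ∧
      ∀ t ∈ Icc 0 T, fderiv ℝ (u (t₀ + t)) = fun x =>
        gaussAvg (√(2 * t)) (fderiv ℝ (u t₀)) x + duhamel k t x := by
  obtain ⟨hd, hcont, hbdd⟩ := hu.fderiv_regularity hp hφ hC
  have ht₀' : t₀ ∈ Ico 0 S := ⟨ht₀.le, by linarith⟩
  have hv := hu.restart hp hφ hC ht₀'
  have hTm : T ∈ Ico 0 (S - t₀) := ⟨hT, by linarith⟩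
  obtain ⟨M₀, -, hM₀⟩ := hu.exists_norm_le ht₀'.2
  obtain ⟨M₁, hM₁⟩ := hbdd t₀ (t₀ + T) ht₀ hTS
  obtain ⟨M, hM⟩ := hv.exists_norm_source_le hp hTm
  obtain ⟨N, hN0, hN⟩ := hv.exists_norm_le hTm.2
  have hpos : ∀ s, 0 < t₀ + clampIcc T s := fun s => by linarith [(clampIcc_mem hT s).1]
  have hlt : ∀ s, t₀ + clampIcc T s < S := fun s => by linarith [(clampIcc_mem hT s).2]
  set k : ℝ → E → E →L[ℝ] ℝ := fun s x =>
    (p * u (t₀ + clampIcc T s) x ^ (p - 1)) • fderiv ℝ (u (t₀ + clampIcc T s)) x with hk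
  have hkc : Continuous fun q : ℝ × E => k q.1 q.2 := by
    have h1 : Continuous fun q : ℝ × E => u (t₀ + clampIcc T q.1) q.2 :=
      continuous_clampIcc_comp (k := fun t => u (t₀ + t)) hv.continuousOn hT
        fun s hs => ⟨hs.1, hs.2.trans_lt hTm.2⟩
    have h2 : Continuous fun q : ℝ × E => fderiv ℝ (u (t₀ + clampIcc T q.1)) q.2 :=
      hcont.comp_continuous (f := fun q : ℝ × E => (t₀ + clampIcc T q.1, q.2))
        ((continuous_const.add ((continuous_clampIcc T).comp continuous_fst)).prodMk
          continuous_snd) fun q => ⟨⟨hpos _, hlt _⟩, mem_univ _⟩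
    exact ((h1.rpow_const fun _ => Or.inr (by linarith)).const_mul p).smul h2
  have hkM : ∀ s x, ‖k s x‖ ≤ p * N ^ (p - 1) * M₁ := by
    intro s x
    have hm := clampIcc_mem hT s
    rw [hk, norm_smul, norm_mul, Real.norm_of_nonneg (by linarith : 0 ≤ p),
      Real.norm_rpow_of_nonneg (hu.nonneg _ ⟨(hpos s).le, hlt s⟩ x)]
    have h1 := hN _ hm x
    have h2 := hM₁ (t₀ + clampIcc T s) ⟨by linarith [hm.1], by linarith [hm.2]⟩ x
    have h3 : ‖u (t₀ + clampIcc T s) x‖ ^ (p - 1) ≤ N ^ (p - 1) :=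
      Real.rpow_le_rpow (norm_nonneg _) h1 (by linarith)
    gcongr
  refine ⟨k, hkc, ⟨_, hkM⟩, fun t ht => ?_⟩
  funext x
  rw [hv.eq_add_duhamel_clamp hTm.2 ht]
  refine HasFDerivAt.fderiv (HasFDerivAt.add ?_ ?_)
  · exact hasFDerivAt_gaussAvg_of_hasFDerivAt (hu.continuous_slice ht₀')
      (fun y => hM₀ t₀ ⟨ht₀.le, le_rfl⟩ y) (continuousOn_slice (k := fun t => fderiv ℝ (u t)) hcont ⟨ht₀, ht₀'.2⟩)
      (fun y => hM₁ t₀ ⟨le_rfl, by linarith⟩ y) (fun y => hd t₀ ⟨ht₀, ht₀'.2⟩ y) _ x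
  · refine hasFDerivAt_duhamel_of_hasFDerivAt (hv.continuous_source hp hTm) hM hkc hkM ht.1
      (fun s hs y => ?_) x
    exact (hd _ ⟨hpos s, hlt s⟩ y).rpow_const (Or.inr hp.le)

/-- Smoothing applied to the gradient, restarted at an arbitrary a > 0; every positive time is
reached by taking a below it. -/
theorem fderiv_fderiv_regularity (hu : IsMildSolution p φ S u) (hp : 1 < p) (hφ : Continuous φ)
    {C : ℝ} (hC : ∀ x, ‖φ x‖ ≤ C) :
    (∀ t ∈ Ioo 0 S, ∀ x, HasFDerivAt (fderiv ℝ (u t)) (fderiv ℝ (fderiv ℝ (u t)) x) x) ∧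
      ContinuousOn (fun q : ℝ × E => fderiv ℝ (fderiv ℝ (u q.1)) q.2) (Ioo 0 S ×ˢ univ) ∧
      ∀ t ∈ Ioo 0 S, ∃ M, ∀ x, ‖fderiv ℝ (fderiv ℝ (u t)) x‖ ≤ M := by
  obtain ⟨hd, hcont, hbdd⟩ := hu.fderiv_regularity hp hφ hC
  have key : ∀ a T, 0 < a → a < T → T < S → ∃ U' : ℝ → E → E →L[ℝ] E →L[ℝ] ℝ,
      (∀ t ∈ Ioc a T, ∀ x, HasFDerivAt (fderiv ℝ (u t)) (U' t x) x) ∧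
      ContinuousOn (fun q : ℝ × E => U' q.1 q.2) (Ioi a ×ˢ univ) ∧
      ∀ t ∈ Ioc a T, ∃ M, ∀ x, ‖U' t x‖ ≤ M := by
    intro a T ha haT hT
    obtain ⟨k, hkc, ⟨M, hM⟩, hk⟩ := hu.fderiv_eq_add_duhamel hp hφ hC ha (sub_nonneg.2 haT.le)
      (by linarith : a + (T - a) < S)
    obtain ⟨M₁, hM₁⟩ := hbdd a a ha (haT.trans hT)
    obtain ⟨U', h1, h2, h3⟩ := exists_hasFDerivAt_of_eq_add_duhamel (T := T - a)
      (U := fun t => fderiv ℝ (u (a + t)))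
      (continuousOn_slice (k := fun t => fderiv ℝ (u t)) hcont ⟨ha, haT.trans hT⟩) (hM₁ a ⟨le_rfl, le_rfl⟩) hkc hM hk
    refine ⟨fun t => U' (t - a), fun t ht x => ?_, ?_, fun t ht => ?_⟩
    · have := h1 (t - a) ⟨by linarith [ht.1], by linarith [ht.2]⟩ x
      simpa using this
    · refine h2.comp (f := fun q : ℝ × E => (q.1 - a, q.2)) (by fun_prop) fun q hq => ⟨?_, mem_univ _⟩
      exact sub_pos.2 (mem_Ioi.1 hq.1)
    · obtain ⟨M, hM⟩ := h3 (t - a) (sub_pos.2 ht.1)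
      exact ⟨M, hM _ ⟨le_rfl, by linarith [ht.2]⟩⟩
  refine ⟨fun t ht x => ?_, ?_, fun t ht => ?_⟩
  · obtain ⟨a, ha1, ha2⟩ := exists_between ht.1
    obtain ⟨U', h1, -⟩ := key a t ha1 ha2 ht.2
    exact (h1 t ⟨ha2, le_rfl⟩ x).differentiableAt.hasFDerivAt
  · refine continuousOn_of_forall_Ioo fun a T ha hT => ?_
    rcases le_or_gt T a with h | h
    · simp [Ioo_eq_empty (not_lt.2 h)]
    obtain ⟨U', h1, h2, -⟩ := key a T ha h hT
    refine (h2.mono (prod_mono (fun t ht => ht.1) le_rfl)).congr fun q hq => ?_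
    exact (h1 q.1 ⟨hq.1.1, hq.1.2.le⟩ q.2).fderiv
  · obtain ⟨a, ha1, ha2⟩ := exists_between ht.1
    obtain ⟨U', h1, -, h3⟩ := key a t ha1 ha2 ht.2
    obtain ⟨M, hM⟩ := h3 t ⟨ha2, le_rfl⟩
    refine ⟨M, fun x => ?_⟩
    rw [(h1 t ⟨ha2, le_rfl⟩ x).fderiv]
    exact hM x

/-- After restarting at t, the right derivative at 0 is the generator applied to u t plus the
initial value of the source. Only the right derivative is accessible this way; its continuity in
time upgrades it to a full derivative. -/
theorem hasDerivWithinAt_time (hu : IsMildSolution p φ S u) (hp : 1 < p) (hφ : Continuous φ)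
    {C : ℝ} (hC : ∀ x, ‖φ x‖ ≤ C) {ι : Type*} [Fintype ι] (b : OrthonormalBasis ι ℝ E) {t : ℝ}
    (ht : t ∈ Ioo 0 S) (x : E) :
    HasDerivWithinAt (fun s => u s x)
      (∑ i, fderiv ℝ (fderiv ℝ (u t)) x (b i) (b i) + u t x ^ p) (Ici t) t := by
  obtain ⟨hd, hcont, hbdd⟩ := hu.fderiv_regularity hp hφ hC
  obtain ⟨hd', hcont', hbdd'⟩ := hu.fderiv_fderiv_regularity hp hφ hC
  have ht' : t ∈ Ico 0 S := ⟨ht.1.le, ht.2⟩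
  have hv := hu.restart hp hφ hC ht'
  obtain ⟨T, hT1, hT2⟩ := exists_between (sub_pos.2 ht.2)
  obtain ⟨M₀, -, hM₀⟩ := hu.exists_norm_le ht.2
  obtain ⟨M₁, hM₁⟩ := hbdd t t ht.1 ht.2
  obtain ⟨M₂, hM₂⟩ := hbdd' t ht
  obtain ⟨M, hM⟩ := hv.exists_norm_source_le hp ⟨hT1.le, hT2⟩
  have h1 := hasDerivWithinAt_heat_zero (hu.continuous_slice ht')
    (hM₀ t ⟨ht.1.le, le_rfl⟩) (continuousOn_slice (k := fun t => fderiv ℝ (u t)) hcont ht) (hM₁ t ⟨le_rfl, le_rfl⟩)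
    (continuousOn_slice (k := fun t => fderiv ℝ (fderiv ℝ (u t))) hcont' ht) hM₂ (hd t ht) (hd' t ht) b x
  have h2 := hasDerivWithinAt_duhamel_zero (hv.continuous_source hp ⟨hT1.le, hT2⟩) hM x
  have h3 : HasDerivWithinAt (fun r => u (t + r) x)
      (∑ i, fderiv ℝ (fderiv ℝ (u t)) x (b i) (b i) + u t x ^ p) (Ici 0) 0 := by
    have h4 := h1.add h2
    rw [clampIcc_eq ⟨le_rfl, hT1.le⟩, add_zero] at h4
    refine h4.congr_of_eventuallyEq ?_ ?_
    · filter_upwards [self_mem_nhdsWithin, mem_nhdsWithin_of_mem_nhds (Iio_mem_nhds hT1)]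
        with r hr0 hrT
      exact congrFun (hv.eq_add_duhamel_clamp hT2 ⟨hr0, le_of_lt hrT⟩) x
    · exact congrFun (hv.eq_add_duhamel_clamp hT2 ⟨le_rfl, hT1.le⟩) x
  have h5 : HasDerivWithinAt (fun s : ℝ => s - t) 1 (Ici t) t :=
    ((hasDerivAt_id t).sub_const t).hasDerivWithinAt
  have h6 := HasDerivWithinAt.scomp_of_eq (x := t) (h := fun s : ℝ => s - t) (s := Ici t) h3 h5
    (fun s hs => mem_Ici.2 (sub_nonneg.2 (mem_Ici.1 hs))) (sub_self t).symm
  simpa [Function.comp_def] using h6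

theorem hasDerivAt_time (hu : IsMildSolution p φ S u) (hp : 1 < p) (hφ : Continuous φ)
    {C : ℝ} (hC : ∀ x, ‖φ x‖ ≤ C) {ι : Type*} [Fintype ι] (b : OrthonormalBasis ι ℝ E) {t : ℝ}
    (ht : t ∈ Ioo 0 S) (x : E) :
    HasDerivAt (fun s => u s x)
      (∑ i, fderiv ℝ (fderiv ℝ (u t)) x (b i) (b i) + u t x ^ p) t := by
  have hcont' := (hu.fderiv_fderiv_regularity hp hφ hC).2.1
  have hmaps : ∀ s ∈ Ioo 0 S, (s, x) ∈ Ioo (0 : ℝ) S ×ˢ (univ : Set E) :=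
    fun s hs => ⟨hs, mem_univ _⟩
  have hf : ContinuousOn (fun s => u s x) (Ioo 0 S) :=
    hu.continuousOn.comp (f := fun s : ℝ => (s, x)) (by fun_prop)
      fun s hs => ⟨⟨hs.1.le, hs.2⟩, mem_univ _⟩
  refine hasDerivAt_of_hasDerivWithinAt_Ici (f := fun s => u s x)
    (g := fun s => ∑ i, fderiv ℝ (fderiv ℝ (u s)) x (b i) (b i) + u s x ^ p) ht hf ?_
    fun s hs => hu.hasDerivWithinAt_time hp hφ hC b hs x
  refine ContinuousOn.add ?_ (hf.rpow_const fun _ _ => Or.inr (by linarith))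
  have h2 : ContinuousOn (fun s => fderiv ℝ (fderiv ℝ (u s)) x) (Ioo 0 S) :=
    hcont'.comp (f := fun s : ℝ => (s, x)) (by fun_prop) hmaps
  exact continuousOn_finsetSum _ fun i _ =>
    (h2.clm_apply continuousOn_const).clm_apply continuousOn_const

end IsMildSolution

end Regularity

/-! ### Mild solutions are classical -/

section Classical

theorem laplacian_eq_sum_fderiv {n : ℕ} (f : RSpace n → ℝ) (x : RSpace n) :
    Laplacian.laplacian f x = ∑ i, fderiv ℝ (fderiv ℝ f) x (EuclideanSpace.basisFun (Fin n) ℝ i)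
      (EuclideanSpace.basisFun (Fin n) ℝ i) := by
  rw [congrFun (InnerProductSpace.laplacian_eq_iteratedFDeriv_orthonormalBasis f
    (EuclideanSpace.basisFun (Fin n) ℝ)) x]
  simp [iteratedFDeriv_two_apply]

theorem continuousOn_iteratedFDeriv_one {E G : Type*} [NormedAddCommGroup E] [NormedSpace ℝ E]
    [NormedAddCommGroup G] [NormedSpace ℝ G] {f : ℝ → E → G} {A : Set (ℝ × E)}
    (hf : ContinuousOn (fun q : ℝ × E => fderiv ℝ (f q.1) q.2) A) :
    ContinuousOn (fun q : ℝ × E => iteratedFDeriv ℝ 1 (f q.1) q.2) A := by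
  simp only [iteratedFDeriv_succ_eq_comp_right, iteratedFDeriv_zero_eq_comp]
  exact (LinearIsometryEquiv.continuous _).comp_continuousOn
    ((LinearIsometryEquiv.continuous _).comp_continuousOn hf)

theorem IsMildSolution.isClassicalSolution {n : ℕ} {p S : ℝ} {φ : RSpace n → ℝ}
    {u : ℝ → RSpace n → ℝ} (hu : IsMildSolution p φ S u) (hp : 1 < p) (hφ : Continuous φ)
    {C : ℝ} (hC : ∀ x, ‖φ x‖ ≤ C) (hS : 0 < S) : IsClassicalSolution p φ S u := by
  obtain ⟨hd, hcont, hbdd⟩ := hu.fderiv_regularity hp hφ hC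
  obtain ⟨hd', hcont', hbdd'⟩ := hu.fderiv_fderiv_regularity hp hφ hC
  set b := EuclideanSpace.basisFun (Fin n) ℝ
  have hsub : Ioo 0 S ×ˢ (univ : Set (RSpace n)) ⊆ Ico 0 S ×ˢ univ :=
    prod_mono Ioo_subset_Ico_self le_rfl
  have htime : ∀ t ∈ Ioo 0 S, ∀ x, HasDerivAt (fun s => u s x)
      (∑ i, fderiv ℝ (fderiv ℝ (u t)) x (b i) (b i) + u t x ^ p) t := fun t ht x =>
    hu.hasDerivAt_time hp hφ hC b ht x
  have hnl : ∀ t ∈ Ico 0 S, ∀ x, |u t x| ^ (p - 1) * u t x = u t x ^ p := by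
    intro t ht x
    have h0 := hu.nonneg t ht x
    rw [abs_of_nonneg h0]
    rcases h0.eq_or_lt with h | h
    · rw [← h, mul_zero, Real.zero_rpow (by linarith)]
    · rw [← Real.rpow_add_one h.ne', sub_add_cancel]
  refine ⟨hu.continuousOn, ?_, ?_, ?_, fun t ht x => (htime t ht x).differentiableAt, ?_, ?_,
    fun x => congrFun (hu.zero hS) x⟩
  · intro T hT
    obtain ⟨M, -, hM⟩ := hu.exists_norm_le hT
    exact ⟨M, hM⟩
  · intro t ht
    have h2 : ContDiff ℝ (1 + 1) (u t) := by
      refine contDiff_succ_iff_fderiv.2 ⟨fun x => (hd t ht x).differentiableAt, by simp, ?_⟩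
      refine contDiff_one_iff_fderiv.2 ⟨fun x => (hd' t ht x).differentiableAt, ?_⟩
      exact continuousOn_slice (k := fun t => fderiv ℝ (fderiv ℝ (u t))) hcont' ht
    rwa [one_add_one_eq_two] at h2
  · intro k hk
    interval_cases k
    · simp only [iteratedFDeriv_zero_eq_comp]
      exact (LinearIsometryEquiv.continuous _).comp_continuousOn (hu.continuousOn.mono hsub)
    · exact continuousOn_iteratedFDeriv_one hcont
    · have h1 := continuousOn_iteratedFDeriv_one (f := fun t => fderiv ℝ (u t)) hcont'
      simp only [iteratedFDeriv_succ_eq_comp_right (n := 1)]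
      exact (LinearIsometryEquiv.continuous _).comp_continuousOn h1
  · have h1 : ContinuousOn (fun q : ℝ × RSpace n =>
        ∑ i, fderiv ℝ (fderiv ℝ (u q.1)) q.2 (b i) (b i) + u q.1 q.2 ^ p) (Ioo 0 S ×ˢ univ) := by
      refine ContinuousOn.add (continuousOn_finsetSum _ fun i _ =>
        (hcont'.clm_apply continuousOn_const).clm_apply continuousOn_const) ?_
      exact (hu.continuousOn.mono hsub).rpow_const fun _ _ => Or.inr (by linarith)
    exact h1.congr fun q hq => (htime q.1 hq.1 q.2).deriv
  · intro t ht x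
    rw [(htime t ht x).deriv, laplacian_eq_sum_fderiv, hnl t ⟨ht.1.le, ht.2⟩ x]

end Classical

/-! ### Local existence by contraction -/

section LocalExistence

variable {E : Type*} [NormedAddCommGroup E] [InnerProductSpace ℝ E] [FiniteDimensional ℝ E]
  [MeasurableSpace E] [BorelSpace E]
variable {F : Type*} [NormedAddCommGroup F] [NormedSpace ℝ F]

theorem norm_duhamel_sub_le {h k : ℝ → E → F} {C C' D : ℝ}
    (hh : Continuous fun q : ℝ × E => h q.1 q.2) (hC : ∀ s y, ‖h s y‖ ≤ C)
    (hk : Continuous fun q : ℝ × E => k q.1 q.2) (hC' : ∀ s y, ‖k s y‖ ≤ C')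
    (hD : ∀ s y, ‖h s y - k s y‖ ≤ D) {t : ℝ} (ht : 0 ≤ t) (x : E) :
    ‖duhamel h t x - duhamel k t x‖ ≤ t * D := by
  have h1 : duhamel h t x - duhamel k t x = duhamel (fun s y => h s y - k s y) t x := by
    have hA : ∀ {h : ℝ → E → F} {C : ℝ}, Continuous (fun q : ℝ × E => h q.1 q.2) →
        (∀ s y, ‖h s y‖ ≤ C) → Continuous fun σ =>
        (2 * t * σ) • gaussAvg (√(2 * t) * σ) (h (t - t * σ ^ 2)) x := fun hh hC =>
      Continuous.smul (by fun_prop) ((continuous_duhamel_integrand hh hC).comp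
        (by fun_prop : Continuous fun σ : ℝ => (((t, x) : ℝ × E), σ)))
    unfold duhamel
    rw [← intervalIntegral.integral_sub ((hA hh hC).intervalIntegrable _ _)
      ((hA hk hC').intervalIntegrable _ _)]
    congr 1
    funext σ
    rw [← smul_sub]
    congr 1
    exact (integral_sub (integrable_gaussAvg (continuousOn_slice (A := univ)
      hh.continuousOn (mem_univ _)) (fun y => hC _ y) _ _)
      (integrable_gaussAvg (continuousOn_slice (A := univ)
      hk.continuousOn (mem_univ _)) (fun y => hC' _ y) _ _)).symm
  rw [h1]
  exact norm_duhamel_le hD ht x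

theorem duhamel_nonneg {h : ℝ → E → ℝ} (hh : ∀ s y, 0 ≤ h s y) {t : ℝ} (ht : 0 ≤ t) (x : E) :
    0 ≤ duhamel h t x := by
  refine intervalIntegral.integral_nonneg zero_le_one fun σ hσ => ?_
  have := hσ.1
  exact smul_nonneg (by positivity) (gaussAvg_nonneg (fun y => hh _ y) _ _)

theorem abs_rpow_sub_rpow_le {p N a b : ℝ} (hp : 1 ≤ p) (ha : a ∈ Icc 0 N) (hb : b ∈ Icc 0 N) :
    |a ^ p - b ^ p| ≤ p * N ^ (p - 1) * |a - b| := by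
  refine (convex_Icc 0 N).norm_image_sub_le_of_norm_hasDerivWithin_le
    (f := fun x : ℝ => x ^ p) (f' := fun x => p * x ^ (p - 1))
    (fun x _ => (Real.hasDerivAt_rpow_const (Or.inr hp)).hasDerivWithinAt) (fun x hx => ?_) hb ha
  rw [Real.norm_of_nonneg (mul_nonneg (by linarith) (Real.rpow_nonneg hx.1 _))]
  exact mul_le_mul_of_nonneg_left (Real.rpow_le_rpow hx.1 hx.2 (by linarith)) (by linarith)

theorem abs_clampIcc_sub_le (N a b : ℝ) : |clampIcc N a - clampIcc N b| ≤ |a - b| := by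
  have h : LipschitzWith 1 (clampIcc N) := (LipschitzWith.id.const_min N).const_max 0
  simpa [Real.dist_eq] using h.dist_le_mul a b

/-- Local existence of mild solutions, on a time interval that depends only on a bound for the
initial datum. -/
theorem exists_isMildSolution {p : ℝ} (hp : 1 < p) {R : ℝ} (hR : 0 ≤ R) :
    ∃ τ > 0, ∀ φ : E → ℝ, Continuous φ → (∀ x, 0 ≤ φ x) → (∀ x, φ x ≤ R) →
      ∃ u : ℝ → E → ℝ, IsMildSolution p φ τ u := by
  set N := R + 1 with hN
  have hN0 : 0 ≤ N := by linarith
  set B := N ^ p with hB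
  set L := p * N ^ (p - 1) with hL
  have hB0 : 0 ≤ B := Real.rpow_nonneg hN0 p
  have hL0 : 0 ≤ L := mul_nonneg (by linarith) (Real.rpow_nonneg hN0 _)
  -- Chosen so that τB ≤ 1, which keeps the solution below N = R + 1, and τL ≤ 1/2, which makes the
  -- map a contraction.
  set τ := (1 + B + 2 * L)⁻¹ with hτ
  have hτ0 : 0 < τ := by positivity
  have hτB : τ * B ≤ 1 := by
    rw [hτ, inv_mul_le_iff₀ (by positivity)]
    linarith
  have hτL : τ * L ≤ 1 / 2 := by
    rw [hτ, inv_mul_le_iff₀ (by positivity)]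
    linarith
  refine ⟨τ, hτ0, fun φ hφ hφ0 hφR => ?_⟩
  have hφn : ∀ x, ‖φ x‖ ≤ R := fun x => by
    rw [Real.norm_of_nonneg (hφ0 x)]
    exact hφR x
  -- The truncated power is bounded and globally Lipschitz, so the contraction acts on all bounded
  -- continuous functions. The fixed point takes values in [0, N] for times in [0, τ], where the
  -- truncation has no effect.
  set g : ℝ → ℝ := fun v => clampIcc N v ^ p with hg
  have hgc : Continuous g :=
    (continuous_clampIcc N).rpow_const fun _ => Or.inr (by linarith)
  have hg0 : ∀ v, 0 ≤ g v := fun v => Real.rpow_nonneg (clampIcc_mem hN0 v).1 p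
  have hgB : ∀ v, ‖g v‖ ≤ B := fun v => by
    rw [Real.norm_of_nonneg (hg0 v)]
    exact Real.rpow_le_rpow (clampIcc_mem hN0 v).1 (clampIcc_mem hN0 v).2 (by linarith)
  have hgL : ∀ v w, ‖g v - g w‖ ≤ L * |v - w| := fun v w =>
    (abs_rpow_sub_rpow_le hp.le (clampIcc_mem hN0 v) (clampIcc_mem hN0 w)).trans
      (mul_le_mul_of_nonneg_left (abs_clampIcc_sub_le N v w) hL0)
  have hsrc : ∀ u : BoundedContinuousFunction (ℝ × E) ℝ,
      Continuous fun q : ℝ × E => g (u (q.1, q.2)) := fun u => hgc.comp u.continuous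
  have hcl : Continuous fun q : ℝ × E => (clampIcc τ q.1, q.2) :=
    ((continuous_clampIcc τ).comp continuous_fst).prodMk continuous_snd
  have hheat : Continuous fun q : ℝ × E => gaussAvg (√(2 * q.1)) φ q.2 :=
    continuous_gaussAvg (X := ℝ × E) (h := fun _ => φ) (hφ.comp continuous_snd)
      (fun _ => hφn) (s := fun q => √(2 * q.1)) (by fun_prop) (y := fun q => q.2) (by fun_prop)
  let Φ : BoundedContinuousFunction (ℝ × E) ℝ → BoundedContinuousFunction (ℝ × E) ℝ := fun u =>
    BoundedContinuousFunction.ofNormedAddCommGroup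
      (fun q : ℝ × E => gaussAvg (√(2 * clampIcc τ q.1)) φ q.2
        + duhamel (fun s x => g (u (s, x))) (clampIcc τ q.1) q.2)
      ((hheat.comp hcl).add ((continuous_duhamel (h := fun s x => g (u (s, x)))
        (hsrc u) (fun _ _ => hgB _)).comp hcl))
      (R + τ * B) (fun q => by
        refine (norm_add_le _ _).trans (add_le_add (norm_gaussAvg_le hφn _ _) ?_)
        have hm := clampIcc_mem hτ0.le q.1
        exact (norm_duhamel_le (fun _ _ => hgB _) hm.1 _).trans
          (mul_le_mul_of_nonneg_right hm.2 hB0))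
  have hΦ : ContractingWith (1 / 2) Φ := by
    refine ⟨by rw [div_lt_one two_pos]; exact one_lt_two, LipschitzWith.of_dist_le_mul fun u v => ?_⟩
    refine (BoundedContinuousFunction.dist_le (by positivity)).2 fun q => ?_
    have hm := clampIcc_mem hτ0.le q.1
    have h1 := norm_duhamel_sub_le (h := fun s x => g (u (s, x))) (k := fun s x => g (v (s, x)))
      (hsrc u) (fun _ _ => hgB _) (hsrc v) (fun _ _ => hgB _)
      (D := L * dist u v) (fun s y => (hgL _ _).trans (mul_le_mul_of_nonneg_left (by
        rw [← Real.dist_eq]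
        exact BoundedContinuousFunction.dist_coe_le_dist _) hL0)) hm.1 q.2
    rw [Real.dist_eq]
    have h2 : Φ u q - Φ v q = duhamel (fun s x => g (u (s, x))) (clampIcc τ q.1) q.2
        - duhamel (fun s x => g (v (s, x))) (clampIcc τ q.1) q.2 :=
      add_sub_add_left_eq_sub _ _ _
    rw [h2]
    refine h1.trans ?_
    rw [← mul_assoc]
    refine mul_le_mul_of_nonneg_right ?_ dist_nonneg
    have h3 : clampIcc τ q.1 * L ≤ τ * L := mul_le_mul_of_nonneg_right hm.2 hL0
    simpa using h3.trans hτL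
  set U := hΦ.fixedPoint Φ with hU
  have hfix : ∀ t ∈ Icc 0 τ, ∀ x, U (t, x) = gaussAvg (√(2 * t)) φ x
      + duhamel (fun s x => g (U (s, x))) t x := by
    intro t ht x
    have h1 : Φ U (t, x) = U (t, x) := by rw [hU, hΦ.fixedPoint_isFixedPt]
    rw [← h1]
    change gaussAvg (√(2 * clampIcc τ t)) φ x
      + duhamel (fun s x => g (U (s, x))) (clampIcc τ t) x = _
    rw [clampIcc_eq ht]
  have hrange : ∀ t ∈ Icc 0 τ, ∀ x, U (t, x) ∈ Icc 0 N := by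
    intro t ht x
    rw [hfix t ht x]
    constructor
    · exact add_nonneg (gaussAvg_nonneg hφ0 _ _) (duhamel_nonneg (fun _ _ => hg0 _) ht.1 x)
    · have h1 := norm_gaussAvg_le hφn (√(2 * t)) x
      have h2 := norm_duhamel_le (h := fun s x => g (U (s, x))) (fun _ _ => hgB _) ht.1 x
      have h3 := (le_abs_self _).trans h1
      have h4 := (le_abs_self _).trans h2
      have h5 : t * B ≤ τ * B := mul_le_mul_of_nonneg_right ht.2 hB0
      linarith
  refine ⟨fun t x => U (t, x), U.continuous.continuousOn, fun T hT => ⟨N, fun t ht x => ?_⟩,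
    fun t ht x => (hrange t ⟨ht.1, ht.2.le⟩ x).1, fun t ht x => ?_⟩
  · exact (hrange t ⟨ht.1, ht.2.trans hT.le⟩ x).2
  · rw [hfix t ⟨ht.1, ht.2.le⟩ x]
    congr 1
    refine congrFun (duhamel_congr ht.1 fun s hs => ?_) x
    funext y
    rw [hg]
    simp only
    rw [clampIcc_eq (hrange s ⟨hs.1, hs.2.trans ht.2.le⟩ y)]

end LocalExistence

/-! ### The weak maximum principle on the whole space -/

section MaximumPrinciple

/-- A negative second derivative would make the point a local maximum too, so f would be locally
constant with zero second derivative. -/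
theorem deriv_deriv_nonneg_of_isLocalMin {f : ℝ → ℝ} {a : ℝ} (h : IsLocalMin f a)
    (hc : ContinuousAt f a) : 0 ≤ deriv (deriv f) a := by
  by_contra! hlt
  have hmax := isLocalMax_of_deriv_deriv_neg hlt h.deriv_eq_zero hc
  have hconst : f =ᶠ[𝓝 a] fun _ => f a := by
    filter_upwards [h, hmax] with x h1 h2
    exact le_antisymm h2 h1
  have h1 : deriv f =ᶠ[𝓝 a] fun _ => 0 := by
    filter_upwards [hconst.eventuallyEq_nhds] with x hx
    rw [hx.deriv_eq, deriv_const]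
  rw [h1.deriv_eq, deriv_const] at hlt
  exact lt_irrefl _ hlt

/-- The second-derivative test on each coordinate line through x; the penalty c‖y‖² contributes 2c
in each of the n directions. -/
theorem laplacian_nonneg_of_isMin {n : ℕ} {f : RSpace n → ℝ} (hf : ContDiff ℝ 2 f) {c : ℝ}
    {x : RSpace n} (hmin : ∀ y, f x + c * ‖x‖ ^ 2 ≤ f y + c * ‖y‖ ^ 2) :
    -(2 * n * c) ≤ Laplacian.laplacian f x := by
  have hf1 : Differentiable ℝ f := hf.differentiable (by norm_num)
  have hf2 : Differentiable ℝ (fderiv ℝ f) :=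
    (hf.fderiv_right (m := 1) (by norm_num)).differentiable (by norm_num)
  rw [laplacian_eq_sum_fderiv]
  set b := EuclideanSpace.basisFun (Fin n) ℝ with hb
  have key : ∀ i, -(2 * c) ≤ fderiv ℝ (fderiv ℝ f) x (b i) (b i) := by
    intro i
    have hline : ∀ r : ℝ, HasDerivAt (fun r : ℝ => x + r • b i) (b i) r := fun r => by
      simpa using ((hasDerivAt_id r).smul_const (b i)).const_add x
    have hn : ∀ r : ℝ, ‖x + r • b i‖ ^ 2 = ‖x‖ ^ 2 + 2 * r * inner ℝ x (b i) + r ^ 2 := by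
      intro r
      rw [norm_add_sq_real, inner_smul_right, norm_smul, b.norm_eq_one, mul_one,
        Real.norm_eq_abs, sq_abs]
      ring
    set ψ : ℝ → ℝ := fun r => f (x + r • b i) + c * ‖x + r • b i‖ ^ 2 with hψ
    have h1 : ∀ r, HasDerivAt ψ
        (fderiv ℝ f (x + r • b i) (b i) + c * (2 * inner ℝ x (b i) + 2 * r)) r := by
      intro r
      have ha := (hf1 (x + r • b i)).hasFDerivAt.comp_hasDerivAt r (hline r)
      have hb : HasDerivAt (fun r : ℝ => ‖x‖ ^ 2 + 2 * r * inner ℝ x (b i) + r ^ 2)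
          (2 * inner ℝ x (b i) + 2 * r) r := by
        have := ((((hasDerivAt_id r).const_mul 2).mul_const (inner ℝ x (b i))).const_add
          (‖x‖ ^ 2)).add (hasDerivAt_pow 2 r)
        refine this.congr_deriv ?_
        simp
      have hs := ha.add (hb.const_mul c)
      refine hs.congr_of_eventuallyEq (Eventually.of_forall fun r => ?_)
      simp only [hψ, Pi.add_apply, Function.comp, hn]
    have h2 : HasDerivAt (deriv ψ) (fderiv ℝ (fderiv ℝ f) x (b i) (b i) + c * 2) 0 := by
      have hd : deriv ψ = fun r =>
          fderiv ℝ f (x + r • b i) (b i) + c * (2 * inner ℝ x (b i) + 2 * r) :=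
        funext fun r => (h1 r).deriv
      rw [hd]
      have ha := (hf2 (x + (0 : ℝ) • b i)).hasFDerivAt.comp_hasDerivAt (0 : ℝ) (hline 0)
      have hb := ha.clm_apply (hasDerivAt_const (0 : ℝ) (b i))
      have hc : HasDerivAt (fun r : ℝ => c * (2 * inner ℝ x (b i) + 2 * r)) (c * 2) 0 := by
        have := (((hasDerivAt_id (0 : ℝ)).const_mul 2).const_add (2 * inner ℝ x (b i))).const_mul c
        simpa using this
      refine (hb.add hc).congr_deriv ?_
      simp
    have hloc : IsLocalMin ψ 0 := Eventually.of_forall fun r => by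
      simpa [hψ] using hmin (x + r • b i)
    have := deriv_deriv_nonneg_of_isLocalMin hloc (h1 0).continuousAt
    rw [h2.deriv] at this
    linarith
  calc -(2 * n * c) = ∑ _i : Fin n, -(2 * c) := by
        rw [Finset.sum_const, Finset.card_univ, Fintype.card_fin, nsmul_eq_mul]
        ring
    _ ≤ _ := Finset.sum_le_sum fun i _ => key i

/-- The weak maximum principle on `ℝⁿ × [0, S)` for bounded supersolutions. -/
theorem nonneg_of_heat_supersolution {n : ℕ} {S K : ℝ} {w : ℝ → RSpace n → ℝ}
    (hcont : ContinuousOn (fun q : ℝ × RSpace n => w q.1 q.2) (Ico 0 S ×ˢ univ))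
    (hbdd : ∀ T < S, ∃ M : ℝ, ∀ t ∈ Icc 0 T, ∀ x, |w t x| ≤ M)
    (hC2 : ∀ t ∈ Ioo 0 S, ContDiff ℝ 2 (w t))
    (hdiff : ∀ t ∈ Ioo 0 S, ∀ x, DifferentiableAt ℝ (fun s => w s x) t)
    (hsuper : ∀ t ∈ Ioo 0 S, ∀ x, w t x < 0 →
      Laplacian.laplacian (w t) x + K * w t x ≤ deriv (fun s => w s x) t)
    (hinit : ∀ x, 0 ≤ w 0 x) : ∀ t ∈ Ico 0 S, ∀ x, 0 ≤ w t x := by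
  intro t₁ ht₁ x₁
  by_contra! hneg
  obtain ⟨M, hM⟩ := hbdd t₁ ht₁.2
  have hM0 : 0 ≤ M := (abs_nonneg _).trans (hM 0 ⟨le_rfl, ht₁.1⟩ 0)
  -- perturbation making the negative minimum attained and the inequality strict
  set a := Real.exp (-K * t₁) * -w t₁ x₁ with ha
  have ha0 : 0 < a := mul_pos (Real.exp_pos _) (by linarith)
  set D := ‖x₁‖ ^ 2 + (2 * n + 1) * t₁ + 1 with hD
  have hD0 : 0 < D := by
    have := ht₁.1
    positivity
  set ε := a / (2 * D) with hε
  have hε0 : 0 < ε := by positivity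
  -- The factor exp(-Kt) removes the zeroth-order term. The coefficient 2n + 1 exceeds Δ‖x‖² = 2n by
  -- one, which leaves the strict surplus ε in the final inequality.
  set v : ℝ × RSpace n → ℝ := fun q =>
    Real.exp (-K * q.1) * w q.1 q.2 + ε * (‖q.2‖ ^ 2 + (2 * n + 1) * q.1) with hv
  have hv1 : v (t₁, x₁) < 0 := by
    have h1 : ε * (‖x₁‖ ^ 2 + (2 * n + 1) * t₁) ≤ ε * D :=
      mul_le_mul_of_nonneg_left (by linarith) hε0.le
    have h2 : ε * D = a / 2 := by
      rw [hε]
      field_simp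
    have h3 : Real.exp (-K * t₁) * w t₁ x₁ = -a := by rw [ha]; ring
    simp only [hv]
    linarith
  set Q := Real.exp (|K| * t₁) * M with hQ
  have hexp : ∀ t ∈ Icc 0 t₁, Real.exp (-K * t) ≤ Real.exp (|K| * t₁) := by
    intro t ht
    apply Real.exp_le_exp.2
    calc -K * t ≤ |K| * t := mul_le_mul_of_nonneg_right (neg_le_abs K) ht.1
      _ ≤ |K| * t₁ := mul_le_mul_of_nonneg_left ht.2 (abs_nonneg K)
  have hlow : ∀ t ∈ Icc 0 t₁, ∀ x, ε * ‖x‖ ^ 2 - Q ≤ v (t, x) := by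
    intro t ht x
    have h1 : |Real.exp (-K * t) * w t x| ≤ Q := by
      rw [abs_mul, abs_of_pos (Real.exp_pos _)]
      exact mul_le_mul (hexp t ht) (hM t ht x) (abs_nonneg _) (Real.exp_pos _).le
    have h2 := (abs_le.1 h1).1
    have h3 : 0 ≤ ε * ((2 * n + 1) * t) := by
      have := ht.1
      positivity
    simp only [hv]
    linarith
  obtain ⟨r, hr0, hr⟩ : ∃ r : ℝ, 0 ≤ r ∧ Q < ε * r ^ 2 := by
    refine ⟨√((Q + 1) / ε), Real.sqrt_nonneg _, ?_⟩
    have hQ0 : 0 ≤ Q := by positivity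
    rw [Real.sq_sqrt (by positivity), mul_div_cancel₀ _ hε0.ne']
    linarith
  have hvc : ContinuousOn v (Icc 0 t₁ ×ˢ univ) := by
    have h1 : ContinuousOn (fun q : ℝ × RSpace n => w q.1 q.2) (Icc 0 t₁ ×ˢ univ) :=
      hcont.mono (prod_mono (fun t ht => ⟨ht.1, ht.2.trans_lt ht₁.2⟩) le_rfl)
    exact ContinuousOn.add (ContinuousOn.mul (by fun_prop) h1) (by fun_prop)
  have hout : ∀ t ∈ Icc 0 t₁, ∀ x, r < ‖x‖ → 0 ≤ v (t, x) := by
    intro t ht x hx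
    have h1 : ε * r ^ 2 ≤ ε * ‖x‖ ^ 2 := by gcongr
    linarith [hlow t ht x]
  have hx₁ : ‖x₁‖ ≤ r := by
    by_contra! h
    exact absurd (hout t₁ ⟨ht₁.1, le_rfl⟩ x₁ h) (not_le.2 hv1)
  obtain ⟨⟨t, x⟩, ⟨(ht : t ∈ Icc 0 t₁), -⟩, hmin⟩ := (isCompact_Icc.prod (isCompact_closedBall (0 : RSpace n) r)
    ).exists_isMinOn ⟨(t₁, x₁), ⟨ht₁.1, le_rfl⟩, by simpa using hx₁⟩
    (hvc.mono (prod_mono le_rfl (subset_univ _)))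
  have hvneg : v (t, x) < 0 :=
    (hmin ⟨⟨ht₁.1, le_rfl⟩, by simpa using hx₁⟩).trans_lt hv1
  have hglob : ∀ s ∈ Icc 0 t₁, ∀ y, v (t, x) ≤ v (s, y) := by
    intro s hs y
    rcases le_or_gt ‖y‖ r with h | h
    · exact hmin ⟨hs, by simpa using h⟩
    · exact hvneg.le.trans (hout s hs y h)
  have hwneg : w t x < 0 := by
    by_contra! h
    have h1 : 0 ≤ ε * (‖x‖ ^ 2 + (2 * n + 1) * t) := by
      have := ht.1
      positivity
    have h2 : 0 ≤ Real.exp (-K * t) * w t x := mul_nonneg (Real.exp_pos _).le h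
    have : 0 ≤ v (t, x) := add_nonneg h2 h1
    linarith
  have ht0 : 0 < t := by
    rcases ht.1.eq_or_lt with h | h
    · rw [← h] at hwneg
      exact absurd (hinit x) (not_le.2 hwneg)
    · exact h
  have htS : t ∈ Ioo 0 S := ⟨ht0, ht.2.trans_lt ht₁.2⟩
  set e := Real.exp (-K * t) with he
  have he0 : 0 < e := Real.exp_pos _
  have hlap : -(2 * n * (ε / e)) ≤ Laplacian.laplacian (w t) x := by
    refine laplacian_nonneg_of_isMin (hC2 t htS) fun y => ?_
    have h1 := hglob t ht y
    simp only [hv, ← he] at h1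
    have h2 : e * w t x + ε * ‖x‖ ^ 2 ≤ e * w t y + ε * ‖y‖ ^ 2 := by linarith
    have h3 : ∀ y, w t y + ε / e * ‖y‖ ^ 2 = e⁻¹ * (e * w t y + ε * ‖y‖ ^ 2) := by
      intro y
      field_simp
    rw [h3, h3]
    gcongr
  have htime : HasDerivAt (fun s => v (s, x))
      (-K * e * w t x + e * deriv (fun s => w s x) t + ε * (2 * n + 1)) t := by
    have h1 : HasDerivAt (fun s : ℝ => Real.exp (-K * s)) (-K * e) t := by
      have := ((hasDerivAt_id t).const_mul (-K)).exp
      simpa [he, mul_comm] using this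
    have h2 : HasDerivAt (fun s : ℝ => ε * (‖x‖ ^ 2 + (2 * n + 1) * s)) (ε * (2 * n + 1)) t := by
      have := (((hasDerivAt_id t).const_mul (2 * (n : ℝ) + 1)).const_add (‖x‖ ^ 2)).const_mul ε
      simpa using this
    exact (h1.mul (hdiff t htS x).hasDerivAt).add h2
  -- The minimum may sit at the final time t₁, so only slopes from the left are used.
  have hle : -K * e * w t x + e * deriv (fun s => w s x) t + ε * (2 * n + 1) ≤ 0 := by
    by_contra! hpos
    have hev := (hasDerivAt_iff_tendsto_slope_left_right.1 htime).1.eventually_const_lt hpos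
    have h0 : ∀ᶠ s in 𝓝[<] t, 0 < s := mem_nhdsWithin_of_mem_nhds (Ioi_mem_nhds ht0)
    obtain ⟨s, hs1, hs2, hs3⟩ := (hev.and (h0.and self_mem_nhdsWithin)).exists
    have hs3 : s < t := hs3
    rw [slope_def_field] at hs1
    have h1 := hglob s ⟨hs2.le, hs3.le.trans ht.2⟩ x
    have h2 : (v (s, x) - v (t, x)) / (s - t) ≤ 0 :=
      div_nonpos_of_nonneg_of_nonpos (by linarith) (by linarith)
    linarith
  have hsup := mul_le_mul_of_nonneg_left (hsuper t htS x hwneg) he0.le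
  have hlap' := mul_le_mul_of_nonneg_left hlap he0.le
  have h5 : e * -(2 * n * (ε / e)) = -(2 * n * ε) := by
    field_simp
  rw [h5] at hlap'
  nlinarith

end MaximumPrinciple

/-! ### The upper bound for the life span -/

section LifeSpanBound

variable {E : Type*} [NormedAddCommGroup E] [InnerProductSpace ℝ E] [FiniteDimensional ℝ E]
  [MeasurableSpace E] [BorelSpace E]

/-- An absolutely continuous `G` with `G' ≥ G ^ p` and `G 0 > 0` cannot live past the blow-up time
of the corresponding ordinary differential equation. -/
theorem mul_le_rpow_of_rpow_le_deriv {p T G₀ : ℝ} (hp : 1 < p) (hG₀ : 0 < G₀) (hT : 0 ≤ T)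
    {g : ℝ → ℝ} (hg : Continuous g)
    (hle : ∀ t ∈ Icc 0 T, (G₀ + ∫ s in (0 : ℝ)..t, g s) ^ p ≤ g t)
    (hnn : ∀ t ∈ Icc 0 T, 0 ≤ g t) : (p - 1) * T ≤ G₀ ^ (1 - p) := by
  set G : ℝ → ℝ := fun t => G₀ + ∫ s in (0 : ℝ)..t, g s with hG
  have hGd : ∀ t, HasDerivAt G (g t) t := fun t =>
    (intervalIntegral.integral_hasDerivAt_right (hg.intervalIntegrable _ _)
      (hg.stronglyMeasurableAtFilter _ _) hg.continuousAt).const_add G₀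
  have hGpos : ∀ t ∈ Icc 0 T, 0 < G t := fun t ht =>
    add_pos_of_pos_of_nonneg hG₀ (intervalIntegral.integral_nonneg ht.1 fun s hs =>
      hnn s ⟨hs.1, hs.2.trans ht.2⟩)
  have hHd : ∀ t ∈ Icc 0 T, HasDerivAt (fun t => G t ^ (1 - p) + (p - 1) * t)
      (g t * (1 - p) * G t ^ (1 - p - 1) + (p - 1) * 1) t := fun t ht =>
    ((hGd t).rpow_const (Or.inl (hGpos t ht).ne')).add ((hasDerivAt_id t).const_mul (p - 1))
  -- The derivative is (1 - p)(g G^(-p) - 1), which is non-positive because g ≥ G^p.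
  have hanti : AntitoneOn (fun t => G t ^ (1 - p) + (p - 1) * t) (Icc 0 T) := by
    refine antitoneOn_of_deriv_nonpos (convex_Icc 0 T)
      (fun t ht => (hHd t ht).continuousAt.continuousWithinAt)
      (fun t ht => (hHd t (interior_subset ht)).differentiableAt.differentiableWithinAt)
      fun t ht => ?_
    have ht' := interior_subset ht
    rw [(hHd t ht').deriv]
    have h1 : 1 ≤ g t * G t ^ (1 - p - 1) := by
      calc (1 : ℝ) = G t ^ p * G t ^ (1 - p - 1) := by
            rw [← Real.rpow_add (hGpos t ht'), show p + (1 - p - 1) = 0 by ring, Real.rpow_zero]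
        _ ≤ _ := mul_le_mul_of_nonneg_right (hle t ht') (Real.rpow_nonneg (hGpos t ht').le _)
    nlinarith
  have h := hanti ⟨le_rfl, hT⟩ ⟨hT, le_rfl⟩ hT
  simp only [mul_zero, add_zero] at h
  have h0 : G 0 = G₀ := by simp [hG]
  rw [h0] at h
  have := Real.rpow_nonneg (hGpos T ⟨hT, le_rfl⟩).le (1 - p)
  linarith

/-- The function F(t) = P_{τ-t} u(t)(a) has F' = P_{τ-t} u(t)^p (a) ≥ F^p by Jensen's inequality,
and F(0) = P_τ φ(a). Taking τ ≥ S keeps τ - t non-negative throughout; no upper limit on τ is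
needed, so the best large τ may be picked afterwards. -/
theorem IsMildSolution.le_of_gaussAvg_pos {p S : ℝ} {φ : E → ℝ} {u : ℝ → E → ℝ}
    (hu : IsMildSolution p φ S u) (hp : 1 < p) (hφ : Continuous φ) {C : ℝ}
    (hC : ∀ x, ‖φ x‖ ≤ C) {τ : ℝ} (hτ : S ≤ τ) {a : E}
    (hpos : 0 < gaussAvg (√(2 * τ)) φ a) :
    S ≤ 1 / (p - 1) * gaussAvg (√(2 * τ)) φ a ^ (1 - p) := by
  set G₀ := gaussAvg (√(2 * τ)) φ a with hG₀
  have hp1 : 0 < p - 1 := by linarith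
  by_contra! hlt
  obtain ⟨T, hT1, hT2⟩ := exists_between hlt
  have hT0 : 0 ≤ T := le_trans (by positivity) hT1.le
  have hTm : T ∈ Ico 0 S := ⟨hT0, hT2⟩
  have hh := hu.continuous_source hp hTm
  obtain ⟨M, hM⟩ := hu.exists_norm_source_le hp hTm
  obtain ⟨N, hN0, hN⟩ := hu.exists_norm_le hT2
  set h : ℝ → E → ℝ := fun s x => u (clampIcc T s) x ^ p with hhdef
  set g : ℝ → ℝ := fun s => gaussAvg (√(2 * (τ - s))) (h s) a with hg
  have hgc : Continuous g :=
    (continuous_heat_shift hh hM τ).comp (by fun_prop : Continuous fun s : ℝ => (s, a))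
  have hnn : ∀ t ∈ Icc 0 T, ∀ x, 0 ≤ u t x := fun t ht x =>
    hu.nonneg t ⟨ht.1, ht.2.trans_lt hT2⟩ x
  have hF : ∀ t ∈ Icc 0 T, gaussAvg (√(2 * (τ - t))) (u t) a = G₀ + ∫ s in (0 : ℝ)..t, g s := by
    intro t ht
    have htτ : 0 ≤ τ - t := by linarith [ht.2]
    have hc1 : Continuous (gaussAvg (√(2 * t)) φ) :=
      continuous_gaussAvg (X := E) (h := fun _ => φ) (hφ.comp continuous_snd)
        (fun _ => hC) continuous_const continuous_id
    have hc2 : Continuous (duhamel h t) :=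
      (continuous_duhamel hh hM).comp (by fun_prop : Continuous fun y : E => (t, y))
    have h1 := gaussAvg_gaussAvg hφ hC (√(2 * (τ - t))) (√(2 * t)) a
    rw [Real.sq_sqrt (by linarith), Real.sq_sqrt (by linarith [ht.1]),
      show 2 * (τ - t) + 2 * t = 2 * τ by ring] at h1
    have h2 := gaussAvg_duhamel hh hM ht.1 htτ a
    rw [add_sub_cancel] at h2
    rw [hu.eq_add_duhamel_clamp hT2 ht, hG₀, ← h1, hg, ← h2]
    exact integral_add (integrable_gaussAvg hc1 (fun y => norm_gaussAvg_le hC _ y) _ a)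
      (integrable_gaussAvg hc2 (fun y => norm_duhamel_le hM ht.1 y) _ a)
  have hle : ∀ t ∈ Icc 0 T, (G₀ + ∫ s in (0 : ℝ)..t, g s) ^ p ≤ g t := by
    intro t ht
    rw [← hF t ht]
    have h1 := gaussAvg_rpow_le (hu.continuous_slice ⟨ht.1, ht.2.trans_lt hT2⟩) (hN t ht)
      (hnn t ht) hp.le (√(2 * (τ - t))) a
    have h2 : h t = fun y => u t y ^ p := by rw [hhdef]; simp only [clampIcc_eq ht]
    rw [hg]
    simp only [h2]
    exact h1
  have hfin := mul_le_rpow_of_rpow_le_deriv hp hpos hT0 hgc hle fun t ht =>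
    gaussAvg_nonneg (fun y => Real.rpow_nonneg (hnn _ (clampIcc_mem hT0 t) y) p) _ _
  have : 1 / (p - 1) * G₀ ^ (1 - p) ≥ T := by
    rw [one_div, ge_iff_le, le_inv_mul_iff₀ hp1]
    exact hfin
  linarith

end LifeSpanBound

/-! ### Non-negativity and uniqueness of classical solutions -/

section Uniqueness

variable {n : ℕ} {p : ℝ} {φ : RSpace n → ℝ}

/-- Where u < 0 and |u| ≤ M, the reaction term is at least M^(p-1) u, so u is a supersolution of a
linear equation there. -/
theorem IsClassicalSolution.nonneg {S : ℝ} {u : ℝ → RSpace n → ℝ}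
    (hu : IsClassicalSolution p φ S u) (hp : 1 < p) (hφ : ∀ x, 0 ≤ φ x) {t : ℝ}
    (ht : t ∈ Ico 0 S) (x : RSpace n) : 0 ≤ u t x := by
  obtain ⟨T, hT1, hT2⟩ := exists_between ht.2
  obtain ⟨M, hM⟩ := hu.bounded T hT2
  have hsub : Ioo 0 T ⊆ Ioo 0 S := Ioo_subset_Ioo_right hT2.le
  refine nonneg_of_heat_supersolution (S := T) (K := M ^ (p - 1)) (w := u)
    (hu.continuousOn.mono (prod_mono (Ico_subset_Ico_right hT2.le) le_rfl))
    (fun T' hT' => ⟨M, fun s hs y => hM s ⟨hs.1, hs.2.trans hT'.le⟩ y⟩)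
    (fun s hs => hu.contDiff_space s (hsub hs))
    (fun s hs => hu.differentiable_time s (hsub hs)) (fun s hs y hneg => ?_)
    (fun y => by rw [hu.initial]; exact hφ y) t ⟨ht.1, hT1⟩ x
  rw [hu.equation s (hsub hs) y]
  have h1 : |u s y| ^ (p - 1) ≤ M ^ (p - 1) :=
    Real.rpow_le_rpow (abs_nonneg _) (hM s ⟨hs.1.le, hs.2.le⟩ y) (by linarith)
  have h2 := mul_le_mul_of_nonpos_right h1 hneg.le
  linarith

/-- Where v < u, the Lipschitz bound for y ^ p on [0, max M₁ M₂] gives v^p - u^p ≥ K (v - u), so the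
maximum principle applies to v - u. Exchanging the two solutions gives uniqueness. -/
theorem IsClassicalSolution.le {S S' : ℝ} {u v : ℝ → RSpace n → ℝ}
    (hu : IsClassicalSolution p φ S u) (hv : IsClassicalSolution p φ S' v) (hp : 1 < p)
    (hφ : ∀ x, 0 ≤ φ x) {t : ℝ} (ht : t ∈ Ico 0 S) (ht' : t ∈ Ico 0 S') (x : RSpace n) :
    u t x ≤ v t x := by
  obtain ⟨T, hT1, hT2⟩ := exists_between (lt_min ht.2 ht'.2)
  obtain ⟨hTS, hTS'⟩ := lt_min_iff.1 hT2
  obtain ⟨M₁, hM₁⟩ := hu.bounded T hTS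
  obtain ⟨M₂, hM₂⟩ := hv.bounded T hTS'
  have hsub : Ioo 0 T ⊆ Ioo 0 S := Ioo_subset_Ioo_right hTS.le
  have hsub' : Ioo 0 T ⊆ Ioo 0 S' := Ioo_subset_Ioo_right hTS'.le
  have hpow : ∀ a : ℝ, 0 ≤ a → |a| ^ (p - 1) * a = a ^ p := by
    intro a ha
    rw [abs_of_nonneg ha]
    rcases ha.eq_or_lt with h | h
    · rw [← h, mul_zero, Real.zero_rpow (by linarith)]
    · rw [← Real.rpow_add_one h.ne', sub_add_cancel]
  rw [← sub_nonneg]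
  refine nonneg_of_heat_supersolution (S := T) (K := p * max M₁ M₂ ^ (p - 1))
    (w := fun t x => v t x - u t x)
    ((hv.continuousOn.mono (prod_mono (Ico_subset_Ico_right hTS'.le) le_rfl)).sub
      (hu.continuousOn.mono (prod_mono (Ico_subset_Ico_right hTS.le) le_rfl)))
    (fun T' hT' => ⟨M₂ + M₁, fun s hs y => (abs_sub _ _).trans (add_le_add
      (hM₂ s ⟨hs.1, hs.2.trans hT'.le⟩ y) (hM₁ s ⟨hs.1, hs.2.trans hT'.le⟩ y))⟩)
    (fun s hs => (hv.contDiff_space s (hsub' hs)).sub (hu.contDiff_space s (hsub hs)))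
    (fun s hs y => (hv.differentiable_time s (hsub' hs) y).sub
      (hu.differentiable_time s (hsub hs) y)) (fun s hs y hneg => ?_)
    (fun y => by rw [hv.initial, hu.initial, sub_self]) t ⟨ht.1, hT1⟩ x
  have hs' : s ∈ Icc 0 T := ⟨hs.1.le, hs.2.le⟩
  have hu0 := hu.nonneg hp hφ ⟨hs.1.le, (hsub hs).2⟩ y
  have hv0 := hv.nonneg hp hφ ⟨hs.1.le, (hsub' hs).2⟩ y
  have hderiv : deriv (fun s => v s y - u s y) s
      = deriv (fun s => v s y) s - deriv (fun s => u s y) s :=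
    deriv_sub (hv.differentiable_time s (hsub' hs) y) (hu.differentiable_time s (hsub hs) y)
  have hlap : Laplacian.laplacian (fun x => v s x - u s x) y
      = Laplacian.laplacian (v s) y - Laplacian.laplacian (u s) y :=
    ContDiffAt.laplacian_sub (hv.contDiff_space s (hsub' hs)).contDiffAt
      (hu.contDiff_space s (hsub hs)).contDiffAt
  rw [hderiv, hlap, hv.equation s (hsub' hs) y, hu.equation s (hsub hs) y, hpow _ hu0, hpow _ hv0]
  have h1 := abs_rpow_sub_rpow_le hp.le (N := max M₁ M₂)
    ⟨hv0, (le_abs_self _).trans ((hM₂ s hs' y).trans (le_max_right _ _))⟩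
    ⟨hu0, (le_abs_self _).trans ((hM₁ s hs' y).trans (le_max_left _ _))⟩
  rw [abs_of_neg (a := v s y - u s y) hneg] at h1
  have h2 := (abs_le.1 h1).1
  linarith

theorem IsClassicalSolution.eq {S S' : ℝ} {u v : ℝ → RSpace n → ℝ}
    (hu : IsClassicalSolution p φ S u) (hv : IsClassicalSolution p φ S' v) (hp : 1 < p)
    (hφ : ∀ x, 0 ≤ φ x) {t : ℝ} (ht : t ∈ Ico 0 S) (ht' : t ∈ Ico 0 S') : u t = v t :=
  funext fun x => le_antisymm (hu.le hv hp hφ ht ht' x) (hv.le hu hp hφ ht' ht x)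

end Uniqueness

/-! ### The maximal solution and its blow-up -/

section MaximalSolution

variable {n : ℕ} {p : ℝ} {φ : RSpace n → ℝ}

theorem IsMildSolution.mono {S T : ℝ} {u : ℝ → RSpace n → ℝ} (hu : IsMildSolution p φ S u)
    (hT : T ≤ S) : IsMildSolution p φ T u where
  continuousOn := hu.continuousOn.mono (prod_mono (Ico_subset_Ico_right hT) le_rfl)
  bounded T' hT' := hu.bounded T' (hT'.trans_le hT)
  nonneg t ht := hu.nonneg t ⟨ht.1, ht.2.trans_le hT⟩
  eq_add_duhamel t ht := hu.eq_add_duhamel t ⟨ht.1, ht.2.trans_le hT⟩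

/-- For continuous f the essential bound holds everywhere, since a set of full Lebesgue measure is
dense. -/
theorem le_of_eLpNorm_top_le {f : RSpace n → ℝ} (hf : Continuous f) {C : NNReal}
    (hC : eLpNorm f ∞ volume ≤ C) (x : RSpace n) : f x ≤ C := by
  have hae : ∀ᵐ y ∂(volume : Measure (RSpace n)), f y ≤ C := by
    filter_upwards [ae_le_eLpNormEssSup (f := f) (μ := (volume : Measure (RSpace n)))] with y hy
    rw [eLpNorm_exponent_top] at hC
    have h1 : ‖f y‖ₑ ≤ C := hy.trans hC
    have h2 : ‖f y‖₊ ≤ C := by exact_mod_cast h1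
    exact (le_abs_self _).trans (by exact_mod_cast h2)
  have hcl : IsClosed {y | f y ≤ C} := isClosed_le hf continuous_const
  have := (Measure.dense_of_ae hae).closure_eq
  rw [hcl.closure_eq] at this
  exact this.ge (mem_univ x)

/-- If the life spans of mild solutions are bounded, then there is a maximal classical solution,
and it blows up in finite time. -/
theorem exists_blowsUpAt (hp : 1 < p) (hφ : Continuous φ) (hφ0 : ∀ x, 0 ≤ φ x) {M : ℝ}
    (hM : ∀ x, φ x ≤ M) {L : ℝ} (hL : ∀ S u, IsMildSolution p φ S u → S ≤ L) :
    ∃ T : ℝ, BlowsUpAt p φ T ∧ T ≤ L := by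
  have hM0 : 0 ≤ M := (hφ0 0).trans (hM 0)
  have hφn : ∀ x, ‖φ x‖ ≤ M := fun x => by
    rw [Real.norm_of_nonneg (hφ0 x)]
    exact hM x
  set A : Set ℝ := {S | ∃ u : ℝ → RSpace n → ℝ, IsMildSolution p φ S u} with hA
  obtain ⟨τ₀, hτ₀, hloc₀⟩ := exists_isMildSolution (E := RSpace n) hp hM0
  have hτA : τ₀ ∈ A := hloc₀ φ hφ hφ0 hM
  have hbdd : BddAbove A := ⟨L, fun S ⟨u, hu⟩ => hL S u hu⟩
  set T := sSup A with hT
  have hT0 : 0 < T := hτ₀.trans_le (le_csSup hbdd hτA)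
  have hex : ∀ S : ℝ, ∃ v : ℝ → RSpace n → ℝ, S < T → IsMildSolution p φ S v := by
    intro S
    by_cases h : S < T
    · obtain ⟨S', ⟨v, hv⟩, hS'⟩ := exists_lt_of_lt_csSup ⟨τ₀, hτA⟩ h
      exact ⟨v, fun _ => hv.mono hS'.le⟩
    · exact ⟨0, fun h' => absurd h' h⟩
  choose v hv using hex
  -- Any existence time strictly between t and T would serve instead of the midpoint: by uniqueness
  -- the value at t is the same.
  set u : ℝ → RSpace n → ℝ := fun t => v ((t + T) / 2) t with hu
  have huniq : ∀ {S u' t}, IsClassicalSolution p φ S u' → t ∈ Ico 0 S → t < T → u' t = u t := by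
    intro S u' t h ht htT
    have h1 : IsClassicalSolution p φ ((t + T) / 2) (v ((t + T) / 2)) :=
      (hv _ (by linarith)).isClassicalSolution hp hφ hφn (by linarith [ht.1])
    exact h.eq h1 hp hφ0 ht ⟨ht.1, by linarith⟩
  have humild : IsMildSolution p φ T u := by
    refine IsMildSolution.of_forall_lt fun S hS => (hv S hS).congr fun t ht => ?_
    exact (huniq ((hv S hS).isClassicalSolution hp hφ hφn (ht.1.trans_lt ht.2)) ht
      (ht.2.trans hS)).symm
  have huclass := humild.isClassicalSolution hp hφ hφn hT0
  -- Gluing on a local solution from time t gives a mild solution up to t + τ, which cannot exceed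
  -- the supremum T. As τ depends only on R, a bound R on u t for some t > T - τ is contradictory;
  -- this yields both maximality and blow-up.
  have hextend : ∀ {R τ : ℝ}, 0 < τ → (∀ ψ : RSpace n → ℝ, Continuous ψ → (∀ x, 0 ≤ ψ x) →
      (∀ x, ψ x ≤ R) → ∃ w : ℝ → RSpace n → ℝ, IsMildSolution p ψ τ w) →
      ∀ t ∈ Ico 0 T, (∀ x, u t x ≤ R) → t + τ ≤ T := by
    intro R τ hτ hloc t ht hR
    obtain ⟨w, hw⟩ := hloc (u t) (humild.continuous_slice ht) (humild.nonneg t ht) hR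
    exact le_csSup hbdd ⟨_, humild.glue hp hφ hφn ht hτ hw⟩
  refine ⟨T, ⟨u, ⟨hT0, huclass, fun S w hS hw => ?_⟩, ?_⟩, csSup_le ⟨τ₀, hτA⟩
    fun S ⟨u, hu⟩ => hL S u hu⟩
  · have hST : S ≤ T := by
      by_contra! hlt
      obtain ⟨N, hN⟩ := hw.bounded T hlt
      have hN0 : 0 ≤ N := (abs_nonneg _).trans (hN 0 ⟨le_rfl, hT0.le⟩ 0)
      obtain ⟨τ, hτ, hloc⟩ := exists_isMildSolution (E := RSpace n) hp hN0
      obtain ⟨t, ht1, ht2⟩ := exists_between (max_lt hT0 (sub_lt_self T hτ))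
      obtain ⟨ht0, htτ⟩ := max_lt_iff.1 ht1
      have := hextend hτ hloc t ⟨ht0.le, ht2⟩ fun x => by
        rw [← huniq hw ⟨ht0.le, ht2.trans hlt⟩ ht2]
        exact (le_abs_self _).trans (hN t ⟨ht0.le, ht2.le⟩ x)
      linarith
    exact ⟨hST, fun t ht x => congrFun (huniq hw ht (ht.2.trans_le hST)) x⟩
  · rw [ENNReal.tendsto_nhds_top_iff_nnreal]
    intro C
    obtain ⟨τ, hτ, hloc⟩ := exists_isMildSolution (E := RSpace n) hp C.2
    filter_upwards [Ioo_mem_nhdsLT (max_lt hT0 (sub_lt_self T hτ))] with t ht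
    obtain ⟨ht0, htτ⟩ := max_lt_iff.1 ht.1
    by_contra! hle
    have htm : t ∈ Ico 0 T := ⟨ht0.le, ht.2⟩
    have := hextend hτ hloc t htm (le_of_eLpNorm_top_le (humild.continuous_slice htm) hle)
    linarith

end MaximalSolution

/-! ### Large distant Gaussians concentrated in a cone -/

section ConicMean

open ProbabilityTheory

variable {E : Type*} [NormedAddCommGroup E] [InnerProductSpace ℝ E] [FiniteDimensional ℝ E]
  [MeasurableSpace E] [BorelSpace E]

/-- Invertible affine maps preserve Lebesgue null sets, and these are Gaussian null sets. -/
theorem ae_stdGaussian_comp_add_smul {P : E → Prop} (hP : ∀ᵐ y, P y) (ξ : E) {η : ℝ}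
    (hη : η ≠ 0) : ∀ᵐ z ∂(stdGaussian E), P (ξ + η • z) := by
  refine stdGaussian_absolutelyContinuous.ae_le (?_ : ∀ᵐ z : E, P (ξ + η • z))
  rw [ae_iff] at hP ⊢
  have h1 : {z : E | ¬P (ξ + η • z)} = (η • ·) ⁻¹' ((fun y => ξ + y) ⁻¹' {y | ¬P y}) := rfl
  rw [h1, Measure.addHaar_preimage_smul _ hη, measure_preimage_add, hP, mul_zero]

theorem exists_lt_stdGaussian_real {ξ : E} {U : Set E} (hU : U ∈ 𝓝 ξ) {c : ℝ} (hc : c < 1) :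
    ∃ η : ℝ, 0 < η ∧ c < (stdGaussian E).real {z | ξ + η • z ∈ U} := by
  obtain ⟨ρ, hρ, hball⟩ := Metric.mem_nhds_iff.1 hU
  have hlim := tendsto_measure_iUnion_atTop (μ := stdGaussian E)
    (s := fun k : ℕ => Metric.ball (0 : E) k)
    (fun i j hij => Metric.ball_subset_ball (Nat.cast_le.2 hij))
  rw [Metric.iUnion_ball_nat, measure_univ] at hlim
  have hlim' := (ENNReal.tendsto_toReal ENNReal.one_ne_top).comp hlim
  rw [ENNReal.toReal_one] at hlim'
  obtain ⟨k, hk⟩ := (hlim'.eventually_const_lt hc).exists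
  -- This scale sends the ball of radius k, whose Gaussian mass exceeds c, into the ball of radius ρ
  -- about ξ; k + 1 avoids division by zero.
  refine ⟨ρ / (k + 1), by positivity, hk.trans_le ?_⟩
  refine measureReal_mono (fun z hz => hball ?_) (measure_ne_top _ _)
  have hz : ‖z‖ < k := by simpa using hz
  have hk0 : (0 : ℝ) < k + 1 := by positivity
  rw [Metric.mem_ball, dist_eq_norm, add_sub_cancel_left, norm_smul,
    Real.norm_of_nonneg (by positivity), div_mul_eq_mul_div, div_lt_iff₀ hk0]
  gcongr
  linarith

/-- If `φ ≥ B` eventually along almost every ray through a neighbourhood of `ξ`, then the averages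
of `φ` over suitable large and distant Gaussians are almost `B`. -/
theorem exists_le_gaussAvg_of_rays {φ : E → ℝ} (hφ : Continuous φ) (hφ0 : ∀ x, 0 ≤ φ x) {M : ℝ}
    (hM : ∀ x, φ x ≤ M) {ξ : E} {U : Set E} (hUo : IsOpen U) (hξ : ξ ∈ U) {B B' : ℝ}
    (hB : 0 < B) (hB' : B' < B) (hray : ∀ᵐ y : E, y ∈ U → ∀ᶠ r : ℝ in atTop, B ≤ φ (r • y))
    (S : ℝ) : ∃ τ ≥ S, ∃ a, B' ≤ gaussAvg (√(2 * τ)) φ a := by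
  -- The mass of U exceeds B' / B, so that B times this mass exceeds B'.
  obtain ⟨η, hη, hη'⟩ := exists_lt_stdGaussian_real (hUo.mem_nhds hξ) ((div_lt_one hB).2 hB')
  set V : Set E := {z | ξ + η • z ∈ U} with hV
  have hVm : MeasurableSet V :=
    (hUo.preimage (by fun_prop : Continuous fun z : E => ξ + η • z)).measurableSet
  rw [div_lt_iff₀ hB] at hη'
  have hφn : ∀ x, ‖φ x‖ ≤ M := fun x => by
    rw [Real.norm_of_nonneg (hφ0 x)]
    exact hM x
  -- Cutting off at B makes the integrand converge to B almost everywhere on V, under the constant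
  -- dominating function B.
  set f : ℕ → E → ℝ := fun k => V.indicator fun z => min (φ ((k : ℝ) • (ξ + η • z))) B with hf
  have hlim : Tendsto (fun k => ∫ z, f k z ∂(stdGaussian E)) atTop
      (𝓝 (∫ z, V.indicator (fun _ => B) z ∂(stdGaussian E))) := by
    refine tendsto_integral_of_dominated_convergence (fun _ => B) (fun k => ?_)
      (integrable_const _) (fun k => Eventually.of_forall fun z => ?_) ?_
    · refine AEStronglyMeasurable.indicator (Continuous.aestronglyMeasurable ?_) hVm
      exact (hφ.comp (by fun_prop)).min continuous_const
    · refine (norm_indicator_le_norm_self _ _).trans ?_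
      rw [Real.norm_of_nonneg (le_min (hφ0 _) hB.le)]
      exact min_le_right _ _
    · filter_upwards [ae_stdGaussian_comp_add_smul hray ξ hη.ne'] with z hz
      by_cases hzV : z ∈ V
      · refine tendsto_const_nhds.congr' ?_
        filter_upwards [tendsto_natCast_atTop_atTop.eventually (hz hzV)] with k hk
        rw [hf]
        simp only [indicator_of_mem hzV]
        rw [min_eq_right hk]
      · simp only [hf, indicator_of_notMem hzV]
        exact tendsto_const_nhds
  rw [integral_indicator_const _ hVm, smul_eq_mul] at hlim
  have hev := hlim.eventually_const_lt hη'
  -- The time is τ = (kη)²/2, so that √(2τ) = kη and the Gaussian centred at kξ is the k-fold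
  -- dilation of a fixed one.
  have hτ : Tendsto (fun k : ℕ => ((k : ℝ) * η) ^ 2 / 2) atTop atTop := by
    refine Tendsto.atTop_div_const two_pos ((tendsto_pow_atTop two_ne_zero).comp ?_)
    exact tendsto_natCast_atTop_atTop.atTop_mul_const hη
  obtain ⟨k, hk1, hk2⟩ := (hev.and (hτ.eventually_ge_atTop S)).exists
  refine ⟨_, hk2, (k : ℝ) • ξ, hk1.le.trans ?_⟩
  rw [mul_div_cancel₀ _ two_ne_zero, Real.sqrt_sq (by positivity)]
  refine integral_mono_of_nonneg (Eventually.of_forall fun z => ?_)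
    (integrable_gaussAvg hφ hφn _ _) (Eventually.of_forall fun z => ?_)
  · exact indicator_nonneg (fun z _ => le_min (hφ0 _) hB.le) z
  · refine (indicator_le_self' (fun z _ => le_min (hφ0 _) hB.le) z).trans ((min_le_left _ _).trans ?_)
    rw [smul_add, smul_smul]

end ConicMean

/-! ### Radial lower limits and the conclusion -/

section LifeSpan

/-- Blow-up for data that are asymptotically at least `A` along almost every ray of an open set. -/
theorem exists_blowsUpAt_of_rays {n : ℕ} {p : ℝ} (hp : 1 < p) {φ : RSpace n → ℝ}
    (hφ : Continuous φ) (hφ0 : ∀ x, 0 ≤ φ x) {M : ℝ} (hM : ∀ x, φ x ≤ M) {ξ : RSpace n}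
    {U : Set (RSpace n)} (hUo : IsOpen U) (hξ : ξ ∈ U) {A : ℝ} (hA : 0 < A)
    (hray : ∀ B < A, ∀ᵐ y : RSpace n, y ∈ U → ∀ᶠ r : ℝ in atTop, B ≤ φ (r • y)) :
    ∃ T : ℝ, BlowsUpAt p φ T ∧ T ≤ 1 / (p - 1) * A ^ (1 - p) := by
  refine exists_blowsUpAt hp hφ hφ0 hM fun S u hu => ?_
  have hp1 : 0 < p - 1 := by linarith
  have hφn : ∀ x, ‖φ x‖ ≤ M := fun x => by
    rw [Real.norm_of_nonneg (hφ0 x)]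
    exact hM x
  -- The average only reaches levels B' < A; continuity of the bound in the level then allows B' →
  -- A.
  have key : ∀ B' ∈ Ioo 0 A, S ≤ 1 / (p - 1) * B' ^ (1 - p) := by
    intro B' hB'
    obtain ⟨B, h1, h2⟩ := exists_between hB'.2
    obtain ⟨τ, hτ, a, ha⟩ := exists_le_gaussAvg_of_rays hφ hφ0 hM hUo hξ (hB'.1.trans h1) h1
      (hray B h2) S
    refine (hu.le_of_gaussAvg_pos hp hφ hφn hτ (hB'.1.trans_le ha)).trans ?_
    exact mul_le_mul_of_nonneg_left (Real.rpow_le_rpow_of_nonpos hB'.1 ha (by linarith))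
      (by positivity)
  have hcont : ContinuousAt (fun B : ℝ => 1 / (p - 1) * B ^ (1 - p)) A :=
    (Real.continuousAt_rpow_const A (1 - p) (Or.inl hA.ne')).const_mul _
  refine ge_of_tendsto (hcont.tendsto.mono_left (nhdsWithin_le_nhds (s := Iio A))) ?_
  filter_upwards [Ioo_mem_nhdsLT hA] with B hB
  exact key B hB

theorem isOpen_conicNhd {n : ℕ} (ξ : RSpace n) (δ : ℝ) : IsOpen (conicNhd ξ δ) := by
  have h0 : ContinuousOn (fun η : RSpace n => ‖η‖⁻¹) {η | η ≠ 0} :=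
    continuous_norm.continuousOn.inv₀ fun η hη => norm_ne_zero_iff.2 hη
  have h1 : ContinuousOn (fun η : RSpace n => ‖ξ - ‖η‖⁻¹ • η‖) {η | η ≠ 0} :=
    (continuousOn_const.sub (h0.smul continuousOn_id)).norm
  exact h1.isOpen_inter_preimage isOpen_ne isOpen_Iio

/-- Polar coordinates carry Lebesgue measure off the origin to a product with the sphere measure, so
null sets of directions give null cones. -/
theorem ae_of_ae_toSphere {n : ℕ} {P : Metric.sphere (0 : RSpace n) 1 → Prop}
    (hP : ∀ᵐ x ∂(volume : Measure (RSpace n)).toSphere, P x) :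
    ∀ᵐ y : RSpace n, ∀ hy : y ≠ 0, P (homeomorphUnitSphereProd (RSpace n) ⟨y, hy⟩).1 := by
  have h1 := Measure.quasiMeasurePreserving_fst (ν := Measure.volumeIoiPow
    (Module.finrank ℝ (RSpace n) - 1)) |>.ae hP
  have h2 := (Measure.measurePreserving_homeomorphUnitSphereProd
    (volume : Measure (RSpace n))).quasiMeasurePreserving.ae h1
  have hm : MeasurableSet ({0}ᶜ : Set (RSpace n)) := (measurableSet_singleton 0).compl
  have h3 : ∀ᵐ y ∂(volume : Measure (RSpace n)).restrict {0}ᶜ,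
      ∀ hy : y ≠ 0, P (homeomorphUnitSphereProd (RSpace n) ⟨y, hy⟩).1 :=
    (ae_restrict_iff_subtype hm).2 (h2.mono fun y hy _ => hy)
  filter_upwards [(ae_restrict_iff' hm).1 h3] with y hy hy0
  exact hy hy0 hy0

theorem eventually_le_of_lt_liminf {α : Type*} {l : Filter α} {f : α → ℝ} (hf : ∀ x, 0 ≤ f x)
    {B : ℝ} (hB : B < liminf f l) : ∀ᶠ x in l, B ≤ f x :=
  (eventually_lt_of_lt_liminf hB (isBoundedUnder_of ⟨0, hf⟩)).mono fun _ => le_of_lt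

theorem ae_rays_of_lt_capEssInf {n : ℕ} {φ : RSpace n → ℝ} (hφ0 : ∀ x, 0 ≤ φ x) {M : ℝ}
    (hM : ∀ x, φ x ≤ M) {ξ : RSpace n} {δ B : ℝ} (hB : B < capEssInf φ ξ δ) :
    ∀ᵐ y : RSpace n, y ∈ conicNhd ξ δ → ∀ᶠ r : ℝ in atTop, B ≤ φ (r • y) := by
  have hcap : MeasurableSet (sphericalCap ξ δ) :=
    ((isOpen_conicNhd ξ δ).preimage continuous_subtype_val).measurableSet
  -- A real `liminf` is meaningful only for bounded functions; the bound M excludes a default value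
  -- here.
  have hrad : ∀ x, 0 ≤ radialLiminf φ x := fun x =>
    le_liminf_of_le (isBoundedUnder_of ⟨M, fun _ => hM _⟩).isCoboundedUnder_ge
      (Eventually.of_forall fun _ => hφ0 _)
  have h1 : ∀ᵐ x ∂(volume : Measure (RSpace n)).toSphere,
      x ∈ sphericalCap ξ δ → B < radialLiminf φ x := by
    rw [← ae_restrict_iff' hcap]
    exact eventually_lt_of_lt_liminf hB (isBoundedUnder_of ⟨0, hrad⟩)
  filter_upwards [ae_of_ae_toSphere h1] with y hy hyc
  have hy0 : 0 < ‖y‖ := norm_pos_iff.2 hyc.1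
  have hcoe : ((homeomorphUnitSphereProd (RSpace n) ⟨y, hyc.1⟩).1 : RSpace n) = ‖y‖⁻¹ • y := by
    simp
  have hmem : (homeomorphUnitSphereProd (RSpace n) ⟨y, hyc.1⟩).1 ∈ sphericalCap ξ δ := by
    change ((homeomorphUnitSphereProd (RSpace n) ⟨y, hyc.1⟩).1 : RSpace n) ∈ conicNhd ξ δ
    rw [hcoe]
    refine ⟨smul_ne_zero (inv_ne_zero hy0.ne') hyc.1, ?_⟩
    rw [norm_smul, norm_inv, norm_norm, inv_mul_cancel₀ hy0.ne', inv_one, one_smul]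
    exact hyc.2
  have h2 := eventually_le_of_lt_liminf (fun r => hφ0 _) (hy hyc.1 hmem)
  -- The ray through y is the ray through its direction, reparametrised by the factor ‖y‖.
  have h3 : Tendsto (fun r : ℝ => r * ‖y‖) atTop atTop := tendsto_id.atTop_mul_const hy0
  filter_upwards [h3.eventually h2] with r hr
  rwa [hcoe, smul_smul, mul_assoc, mul_inv_cancel₀ hy0.ne', mul_one] at hr

theorem theorem3 (p : ℝ) (hp : 1 < p) :
    (∀ (n : ℕ) (φ : RSpace n → ℝ) (ξ : RSpace n) (δ : ℝ), 2 ≤ n →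
      Continuous φ → (∀ x, 0 ≤ φ x) → (∃ M : ℝ, ∀ x, φ x ≤ M) →
      ‖ξ‖ = 1 → 0 < δ → 0 < capEssInf φ ξ δ →
        ∃ T : ℝ, BlowsUpAt p φ T ∧ T ≤ 1 / (p - 1) * (capEssInf φ ξ δ) ^ (1 - p)) ∧
    (∀ φ : RSpace 1 → ℝ,
      Continuous φ → (∀ x, 0 ≤ φ x) → (∃ M : ℝ, ∀ x, φ x ≤ M) →
      0 < lineLiminfMax φ →
        ∃ T : ℝ, BlowsUpAt p φ T ∧ T ≤ 1 / (p - 1) * (lineLiminfMax φ) ^ (1 - p)) := by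
  refine ⟨fun n φ ξ δ _ hφ hφ0 ⟨M, hM⟩ hξ hδ hA => ?_, fun φ hφ hφ0 ⟨M, hM⟩ hA => ?_⟩
  · refine exists_blowsUpAt_of_rays hp hφ hφ0 hM (isOpen_conicNhd ξ δ) (ξ := ξ) ?_ hA
      fun B hB => ae_rays_of_lt_capEssInf hφ0 hM hB
    refine ⟨norm_ne_zero_iff.1 (by rw [hξ]; exact one_ne_zero), ?_⟩
    simpa [hξ] using hδ
  · have hsmul : ∀ (r : ℝ) (y : RSpace 1), r • y = !₂[r * y 0] := by
      intro r y
      ext i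
      fin_cases i
      simp
    have hcoord : Continuous fun y : RSpace 1 => y 0 := by fun_prop
    -- The open set of rays is the half-line on whose side the larger lower limit is attained; all
    -- its rays coincide up to scaling, so no null set has to be excluded.
    rcases max_choice (liminf (fun x : ℝ => φ !₂[x]) atTop) (liminf (fun x : ℝ => φ !₂[x]) atBot)
      with h | h
    · refine exists_blowsUpAt_of_rays hp hφ hφ0 hM (isOpen_lt (continuous_const (y := (0 : ℝ))) hcoord)
        (ξ := !₂[1]) (by simp) hA fun B hB => Eventually.of_forall fun y hy => ?_
      rw [lineLiminfMax, h] at hB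
      have h1 : Tendsto (fun r : ℝ => r * y 0) atTop atTop :=
        tendsto_id.atTop_mul_const hy
      filter_upwards [h1.eventually (eventually_le_of_lt_liminf (fun x => hφ0 _) hB)] with r hr
      rwa [hsmul]
    · refine exists_blowsUpAt_of_rays hp hφ hφ0 hM (isOpen_lt hcoord (continuous_const (y := (0 : ℝ))))
        (ξ := !₂[-1]) (by simp) hA fun B hB => Eventually.of_forall fun y hy => ?_
      rw [lineLiminfMax, h] at hB
      have h1 : Tendsto (fun r : ℝ => r * y 0) atTop atBot :=
        tendsto_id.atTop_mul_const_of_neg hy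
      filter_upwards [h1.eventually (eventually_le_of_lt_liminf (fun x => hφ0 _) hB)] with r hr
      rwa [hsmul]

end LifeSpan
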